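/- For a nonzero rational function $P\in\mathbb{C}(x_1,\dots,x_n)$ let \[ \mathrm{m}(P)=\frac{1}{(2\pi i)^n}\int_{|x_1|=\cdots=|x_n|=1}\log|P(x_1,\dots,x_n)|\,\frac{dx_1}{x_1}\cdots\frac{dx_n}{x_n} \] denote its logarithmic Mahler measure. Then all the Mahler measures below exist (the integrals converge absolutely), and the following identities hold. (a) As polynomials in the five variables $x,y,z,u,w$, \begin{align*} \mathrm{m}\bigl((x^2+x+1)(1+w)(1+u)z+(x^2-1)(1-w)(1+y)\bigr)&=\frac{93}{\pi^4}\zeta(5),\\ \mathrm{m}\bigl((x^4-x^3+x^2-x+1)(1+w)(1+u)z+(x^4-x^3+x-1)(1-w)(1+y)\bigr)&=\frac{93}{\pi^4}\zeta(5),\\ \mathrm{m}\bigl((x^5+x^4+x+1)(1+w)(1+u)z+(x^5-1)(1-w)(1+y)\bigr)&=\frac{93}{\pi^4}\zeta(5). \end{align*} (b) For $m\ge 1$ put \[ p_m=\prod_{i=1}^m\frac{1-x_i}{1+x_i},\qquad \widetilde p_m=\frac{x_1^2-1}{x_1^2+x_1+1}\prod_{i=2}^m\frac{1-x_i}{1+x_i},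 \] and \begin{align*} R_m(x_1,\dots,x_m,z)&=z+p_m,\\ S_m(x_1,\dots,x_m,x,y,z)&=(1+x)z+p_m(1+y),\\ T_m(x_1,\dots,x_m,x,y)&=1+p_m x+(1-p_m)y, \end{align*} and let $\widetilde R_m,\widetilde S_m,\widetilde T_m$ be the rational functions given by the same formulas with $\widetilde p_m$ in place of $p_m$. Then for every $m\ge1$, \[ \mathrm{m}(\widetilde R_m)=\mathrm{m}(R_m),\qquad \mathrm{m}(\widetilde S_m)=\mathrm{m}(S_m),\qquad \mathrm{m}(\widetilde T_m)=\mathrm{m}(T_m). \] -/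

import Mathlib

open MeasureTheory

noncomputable section

namespace MahlerInv

/-- The field `ℂ(x_0, …, x_{n-1})` of rational functions in `n` variables. -/
abbrev RatFun (n : ℕ) : Type := FractionRing (MvPolynomial (Fin n) ℂ)

/-- The `i`-th variable, as a rational function. -/
def var {n : ℕ} (i : Fin n) : RatFun n :=
  algebraMap (MvPolynomial (Fin n) ℂ) (RatFun n) (MvPolynomial.X i)

/-- The value of a rational function, written in lowest terms, at a point of `ℂⁿ`
(with value `0` where the reduced denominator vanishes). -/
def RatFun.eval {n : ℕ} (P : RatFun n) (x : Fin n → ℂ) : ℂ :=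
  MvPolynomial.eval x (IsFractionRing.num (MvPolynomial (Fin n) ℂ) P) /
    MvPolynomial.eval x (IsFractionRing.den (MvPolynomial (Fin n) ℂ) P : MvPolynomial (Fin n) ℂ)

/-- The integral defining the Mahler measure of `P` converges absolutely: `log |P|` is integrable
over the unit torus. -/
def HasMahlerMeasure {n : ℕ} (P : RatFun n) : Prop :=
  TorusIntegrable (fun x => Real.log ‖P.eval x‖) (0 : Fin n → ℂ) (1 : Fin n → ℝ)

/-- The logarithmic Mahler measure: the mean of `log |P|` over the unit torus
`{(exp (i θ_0), …, exp (i θ_{n-1}))}` with respect to normalized Haar measure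
(on the torus, `dx / (2 π i x) = dθ / (2 π)`). -/
def mahlerMeasure {n : ℕ} (P : RatFun n) : ℝ :=
  ((2 * Real.pi) ^ n)⁻¹ *
    ∫ θ in Set.Icc (0 : Fin n → ℝ) (fun _ => 2 * Real.pi),
      Real.log ‖P.eval (torusMap 0 1 θ)‖

/-- `((1 - x_1) / (1 + x_1)) ⋯ ((1 - x_m) / (1 + x_m))`. -/
def factorProd {n m : ℕ} (x : Fin m → RatFun n) : RatFun n :=
  ∏ i : Fin m, (1 - x i) / (1 + x i)

/-- The same product with its first factor replaced by `(x_1² - 1) / (x_1² + x_1 + 1)`. -/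
def factorProdTilde {n m : ℕ} (x : Fin m → RatFun n) : RatFun n :=
  ∏ i : Fin m, if (i : ℕ) = 0 then (x i ^ 2 - 1) / (x i ^ 2 + x i + 1) else (1 - x i) / (1 + x i)

/-- `R_m(x_1, …, x_m, z)`, with the variables in this order. -/
def R (m : ℕ) : RatFun (m + 1) :=
  let z := var (Fin.natAdd m 0)
  z + factorProd (fun i : Fin m => var (Fin.castAdd 1 i))

/-- The transform of `R_m`. -/
def RTilde (m : ℕ) : RatFun (m + 1) :=
  let z := var (Fin.natAdd m 0)
  z + factorProdTilde (fun i : Fin m => var (Fin.castAdd 1 i))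

/-- `S_m(x_1, …, x_m, x, y, z)`, with the variables in this order. -/
def S (m : ℕ) : RatFun (m + 3) :=
  let x := var (Fin.natAdd m 0)
  let y := var (Fin.natAdd m 1)
  let z := var (Fin.natAdd m 2)
  (1 + x) * z + factorProd (fun i : Fin m => var (Fin.castAdd 3 i)) * (1 + y)

/-- The transform of `S_m`. -/
def STilde (m : ℕ) : RatFun (m + 3) :=
  let x := var (Fin.natAdd m 0)
  let y := var (Fin.natAdd m 1)
  let z := var (Fin.natAdd m 2)
  (1 + x) * z + factorProdTilde (fun i : Fin m => var (Fin.castAdd 3 i)) * (1 + y)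

/-- `T_m(x_1, …, x_m, x, y)`, with the variables in this order. -/
def T (m : ℕ) : RatFun (m + 2) :=
  let x := var (Fin.natAdd m 0)
  let y := var (Fin.natAdd m 1)
  let p := factorProd (fun i : Fin m => var (Fin.castAdd 2 i))
  1 + p * x + (1 - p) * y

/-- The transform of `T_m`. -/
def TTilde (m : ℕ) : RatFun (m + 2) :=
  let x := var (Fin.natAdd m 0)
  let y := var (Fin.natAdd m 1)
  let p := factorProdTilde (fun i : Fin m => var (Fin.castAdd 2 i))
  1 + p * x + (1 - p) * y

/-- `a(x) (1 + w) (1 + u) z + b(x) (1 - w) (1 + y)` in the five variables `x, y, z, u, w`. -/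
def fiveVar (a b : RatFun 5 → RatFun 5) : RatFun 5 :=
  let x := var 0
  let y := var 1
  let z := var 2
  let u := var 3
  let w := var 4
  a x * (1 + w) * (1 + u) * z + b x * (1 - w) * (1 + y)

def P₁ : RatFun 5 :=
  fiveVar (fun x => x ^ 2 + x + 1) (fun x => x ^ 2 - 1)

def P₂ : RatFun 5 :=
  fiveVar (fun x => x ^ 4 - x ^ 3 + x ^ 2 - x + 1) (fun x => x ^ 4 - x ^ 3 + x - 1)

def P₃ : RatFun 5 :=
  fiveVar (fun x => x ^ 5 + x ^ 4 + x + 1) (fun x => x ^ 5 - 1)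

end MahlerInv

end

noncomputable section

namespace MahlerInv

/-! Suppose `a`, `b` are such that `(a + b) / (a - b)` is a finite Blaschke product `β` vanishing at
the origin. By the mean value property all nonzero Fourier coefficients of the image of Haar measure
under `β` vanish, so `β`, and with it `β⁻¹`, preserves Haar measure on the circle
(`measurePreserving_of_diffContOnCl`). The Cayley transform `(1 - x) / (1 + x)` evaluated at `β⁻¹`
is `b / a` (`exists_measurePreserving_of_blaschke`). Hence replacing `(1 - x) / (1 + x)` by `b / a`
changes no Mahler measure, which is (b). In (a), dividing by `a(x) (1 + w)`, whose Mahler measure is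
zero, leaves a transform of `S 2`, so all three values equal that of `S 2`
(`mahlerMeasure_fiveVar`).

For `S 2`, Jensen's formula in `z` leaves the mean of `log⁺ (t |1 + y| / |1 + x|)` with `t = |p_2|`.
The variable `t` has density `4/π² · log t / (t² - 1)` on the half-line
(`lintegral_lintegral_norm_cayley`). For fixed `t ≤ 1` the mean is `4/π² ∑ t^a / a³` over odd `a`
(`ratioLog_eq_tsum`); passing from `t` to `1/t` adds `-log t` (`ratioLog_inv`). Integrating over `t`
gives `∑ 1/a³` and the double sum `∑ 1/(a³ (a + b)²)` over odd `a`, `b`. The latter is reduced to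
single sums by a Fourier series and partial fractions (`tsum_tornheim`, `hasSum_double`). The sums
of cubes cancel, and `96/π⁴ · ∑ 1/a⁵ = 96/π⁴ · 31/32 · ζ(5)` remains.

Convergence is general: `log |P|` is integrable on the torus for every rational `P`
(`hasMahlerMeasure`), by induction on the number of variables. -/

/-! ### Haar measure on the circle and the torus. -/

instance instMeasurableSpaceCircle : MeasurableSpace Circle := borel Circle

instance instBorelSpaceCircle : BorelSpace Circle := ⟨rfl⟩

lemma continuous_circle_coe : Continuous fun x : Circle => (x : ℂ) := continuous_subtype_val

/-- The normalized arc length measure on the unit circle. -/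
def arc : Measure Circle :=
  (ENNReal.ofReal (2 * Real.pi))⁻¹ •
    (volume.restrict (Set.Icc 0 (2 * Real.pi))).map Circle.exp

/-- A point of the torus, as a point of `ℂⁿ`. -/
def toC {n : ℕ} (x : Fin n → Circle) : Fin n → ℂ := fun i => (x i : ℂ)

lemma continuous_toC {n : ℕ} : Continuous (toC (n := n)) :=
  continuous_pi fun i => continuous_circle_coe.comp (continuous_apply i)

/-- The normalized Haar measure on the torus `Circleⁿ`. -/
abbrev torus (n : ℕ) : Measure (Fin n → Circle) := Measure.pi fun _ => arc

lemma measurable_circleExp : Measurable Circle.exp := Circle.exp.continuous.measurable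

lemma ofReal_two_pi_ne_zero : ENNReal.ofReal (2 * Real.pi) ≠ 0 := by
  simpa using Real.pi_pos

instance instIsProbabilityMeasureArc : IsProbabilityMeasure arc := by
  refine ⟨?_⟩
  rw [arc, Measure.smul_apply, Measure.map_apply measurable_circleExp MeasurableSet.univ]
  simp only [Set.preimage_univ, Measure.restrict_apply_univ, Real.volume_Icc, sub_zero, smul_eq_mul]
  exact ENNReal.inv_mul_cancel ofReal_two_pi_ne_zero ENNReal.ofReal_ne_top

lemma pi_const_smul {n : ℕ} {α : Type*} [MeasurableSpace α] (c : ENNReal) (μ : Measure α)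
    [SigmaFinite μ] [SigmaFinite (c • μ)] :
    Measure.pi (fun _ : Fin n => c • μ) = c ^ n • Measure.pi (fun _ : Fin n => μ) := by
  refine Measure.pi_eq fun s _ => ?_
  simp [Measure.pi_pi, Finset.prod_mul_distrib]

/-- The bridge from integrals over the cube of angles, used in the definitions, to the product
probability measure on `Circleⁿ`, used in the proofs. -/
lemma torus_eq (n : ℕ) : torus n = ((ENNReal.ofReal (2 * Real.pi))⁻¹) ^ n •
    (volume.restrict (Set.Icc (0 : Fin n → ℝ) (fun _ => 2 * Real.pi))).map
      (fun θ i => Circle.exp (θ i)) := by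
  have h1 : IsFiniteMeasure ((volume.restrict (Set.Icc 0 (2 * Real.pi))).map Circle.exp) :=
    Measure.isFiniteMeasure_map _ _
  have h2 : SigmaFinite ((ENNReal.ofReal (2 * Real.pi))⁻¹ •
      (volume.restrict (Set.Icc 0 (2 * Real.pi))).map Circle.exp) :=
    inferInstanceAs (SigmaFinite arc)
  have h3 : Set.Icc (0 : Fin n → ℝ) (fun _ => 2 * Real.pi) =
      Set.univ.pi fun _ => Set.Icc 0 (2 * Real.pi) := by
    rw [Set.pi_univ_Icc]; rfl
  unfold torus arc
  rw [pi_const_smul, h3, volume_pi, Measure.restrict_pi_pi,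
    Measure.pi_map_pi fun _ => measurable_circleExp.aemeasurable]

lemma torusMap_eq_exp {n : ℕ} (θ : Fin n → ℝ) :
    torusMap 0 1 θ = toC fun i => Circle.exp (θ i) := by
  ext i; simp [torusMap, toC]

lemma measurable_eval_mvPolynomial {n : ℕ} (p : MvPolynomial (Fin n) ℂ) :
    Measurable fun x : Fin n → Circle => MvPolynomial.eval (toC x) p :=
  (p.continuous_eval.comp continuous_toC).measurable

lemma measurable_eval {n : ℕ} (P : RatFun n) :
    Measurable fun x : Fin n → Circle => P.eval (toC x) :=
  (measurable_eval_mvPolynomial _).div (measurable_eval_mvPolynomial _)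

lemma measurable_log_norm_eval {n : ℕ} (P : RatFun n) :
    Measurable fun x : Fin n → Circle => Real.log ‖P.eval (toC x)‖ :=
  Real.measurable_log.comp (measurable_eval P).norm

lemma measurable_torusExp (n : ℕ) : Measurable fun (θ : Fin n → ℝ) i => Circle.exp (θ i) :=
  measurable_pi_lambda _ fun i => measurable_circleExp.comp (measurable_pi_apply i)

lemma hasMahlerMeasure_iff {n : ℕ} (P : RatFun n) : HasMahlerMeasure P ↔
    Integrable (fun x : Fin n → Circle => Real.log ‖P.eval (toC x)‖) (torus n) := by
  rw [torus_eq, integrable_smul_measure (pow_ne_zero _ (ENNReal.inv_ne_zero.2 ENNReal.ofReal_ne_top))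
    (ENNReal.pow_ne_top (ENNReal.inv_ne_top.2 ofReal_two_pi_ne_zero)),
    integrable_map_measure (measurable_log_norm_eval P).aestronglyMeasurable
      (measurable_torusExp n).aemeasurable]
  simp only [HasMahlerMeasure, TorusIntegrable, IntegrableOn, torusMap_eq_exp]
  rfl

lemma mahlerMeasure_eq {n : ℕ} (P : RatFun n) : mahlerMeasure P =
    ∫ x : Fin n → Circle, Real.log ‖P.eval (toC x)‖ ∂torus n := by
  rw [torus_eq, integral_smul_measure, integral_map (measurable_torusExp n).aemeasurable
    (measurable_log_norm_eval P).aestronglyMeasurable, mahlerMeasure]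
  simp only [torusMap_eq_exp, smul_eq_mul, ENNReal.toReal_pow, ENNReal.toReal_inv,
    ENNReal.toReal_ofReal Real.two_pi_pos.le, inv_pow]

lemma integral_arc {E : Type*} [NormedAddCommGroup E] [NormedSpace ℝ E] {f : ℂ → E}
    (hf : AEStronglyMeasurable (fun x : Circle => f x) arc) :
    ∫ x : Circle, f x ∂arc = Real.circleAverage f 0 1 := by
  have h0 : (ENNReal.ofReal (2 * Real.pi))⁻¹ ≠ 0 := ENNReal.inv_ne_zero.2 ENNReal.ofReal_ne_top
  have hf' : AEStronglyMeasurable (fun x : Circle => f x)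
      ((volume.restrict (Set.Icc 0 (2 * Real.pi))).map Circle.exp) := by
    refine hf.mono_ac ?_
    exact Measure.absolutelyContinuous_smul h0
  rw [arc, integral_smul_measure, integral_map measurable_circleExp.aemeasurable hf',
    Real.circleAverage_def, intervalIntegral.integral_of_le Real.two_pi_pos.le,
    integral_Icc_eq_integral_Ioc, ENNReal.toReal_inv, ENNReal.toReal_ofReal Real.two_pi_pos.le]
  simp [circleMap]

lemma integrable_arc_iff {E : Type*} [NormedAddCommGroup E] {f : ℂ → E}
    (hf : AEStronglyMeasurable (fun x : Circle => f x) arc) :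
    Integrable (fun x : Circle => f x) arc ↔ CircleIntegrable f 0 1 := by
  have h0 : (ENNReal.ofReal (2 * Real.pi))⁻¹ ≠ 0 := ENNReal.inv_ne_zero.2 ENNReal.ofReal_ne_top
  have hf' : AEStronglyMeasurable (fun x : Circle => f x)
      ((volume.restrict (Set.Icc 0 (2 * Real.pi))).map Circle.exp) := by
    refine hf.mono_ac ?_
    exact Measure.absolutelyContinuous_smul h0
  rw [arc, integrable_smul_measure h0 (ENNReal.inv_ne_top.2 ofReal_two_pi_ne_zero),
    integrable_map_measure hf' measurable_circleExp.aemeasurable, CircleIntegrable,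
    intervalIntegrable_iff_integrableOn_Icc_of_le Real.two_pi_pos.le, IntegrableOn]
  simp [circleMap, Function.comp_def]

lemma lintegral_arc {f : Circle → ENNReal} (hf : Measurable f) :
    ∫⁻ x, f x ∂arc = (ENNReal.ofReal (2 * Real.pi))⁻¹ *
      ∫⁻ θ in Set.Icc 0 (2 * Real.pi), f (Circle.exp θ) := by
  rw [arc, lintegral_smul_measure, lintegral_map hf measurable_circleExp, smul_eq_mul]

/-! ### Measure-preserving self-maps of the circle. -/

/-- Finite measures on the circle are determined by their Fourier coefficients. -/
lemma circle_measure_ext {μ ν : Measure Circle} [IsFiniteMeasure μ] [IsFiniteMeasure ν]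
    (h : ∀ n : ℤ, ∫ x : Circle, ((x ^ n : Circle) : ℂ) ∂μ = ∫ x : Circle, ((x ^ n : Circle) : ℂ) ∂ν) :
    μ = ν := by
  -- The coordinate function separates points, and its conjugate on the circle is its inverse, so
  -- the star algebra it generates is spanned by the characters `x ^ n`.
  let e : BoundedContinuousFunction Circle ℂ :=
    BoundedContinuousFunction.mkOfCompact ⟨fun x => (x : ℂ), continuous_circle_coe⟩
  refine ext_of_forall_mem_subalgebra_integral_eq_of_polish (𝕜 := ℂ)
    (A := StarAlgebra.adjoin ℂ {e}) ?_ ?_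
  · intro x y hxy
    refine ⟨e, ⟨⟨e, ⟨e, StarAlgebra.subset_adjoin ℂ _ rfl, rfl⟩, rfl⟩, ?_⟩⟩
    exact fun h => hxy (Circle.ext h)
  · intro g hg
    have hg' : g ∈ Algebra.adjoin ℂ ({e} ∪ star {e}) := hg
    rw [← Subalgebra.mem_toSubmodule, Algebra.adjoin_eq_span] at hg'
    clear hg
    induction hg' using Submodule.span_induction with
    | mem g hg =>
      obtain ⟨n, hn⟩ : ∃ n : ℤ, ∀ x : Circle, g x = ((x ^ n : Circle) : ℂ) := by
        clear h
        induction hg using Submonoid.closure_induction with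
        | mem g hg =>
          rcases hg with rfl | hg
          · exact ⟨1, fun x => by simp [e]⟩
          · refine ⟨-1, fun x => ?_⟩
            rw [← star_star g, (by simpa using hg : star g = e)]
            simp only [zpow_neg, zpow_one, Circle.coe_inv_eq_conj]
            rfl
        | one => exact ⟨0, fun x => by simp⟩
        | mul g g' _ _ h1 h2 =>
          obtain ⟨n, hn⟩ := h1
          obtain ⟨m, hm⟩ := h2
          exact ⟨n + m, fun x => by simp [hn, hm, zpow_add]⟩
      simpa [hn] using h n
    | zero => simp
    | add g g' _ _ h1 h2 =>
      simp only [BoundedContinuousFunction.coe_add, Pi.add_apply]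
      rw [integral_add (g.integrable _) (g'.integrable _), integral_add (g.integrable _)
        (g'.integrable _), h1, h2]
    | smul c g _ h1 =>
      simp only [BoundedContinuousFunction.coe_smul]
      rw [integral_smul, integral_smul, h1]

/-- For a natural exponent `k` the mean of the holomorphic function `B ^ k` is its value `B 0 ^ k`
at the centre; negative exponents follow by conjugation. -/
lemma integral_zpow_comp_arc {B : ℂ → ℂ} (hB : DiffContOnCl ℂ B (Metric.ball 0 1)) (h0 : B 0 = 0)
    {φ : Circle → Circle} (hφc : Continuous φ) (hφ : ∀ x : Circle, (φ x : ℂ) = B x) (n : ℤ) :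
    ∫ x : Circle, ((φ x ^ n : Circle) : ℂ) ∂arc = if n = 0 then 1 else 0 := by
  have key : ∀ k : ℕ, ∫ x : Circle, ((φ x ^ k : Circle) : ℂ) ∂arc = if k = 0 then 1 else 0 := by
    intro k
    have hc : Continuous fun x : Circle => B x ^ k := by
      simp_rw [← hφ]
      exact (continuous_circle_coe.comp hφc).pow k
    simp only [Circle.coe_pow, hφ]
    rw [integral_arc (f := fun z => B z ^ k) hc.aestronglyMeasurable]
    have hd : DiffContOnCl ℂ (fun z => B z ^ k) (Metric.ball 0 |(1 : ℝ)|) := by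
      rw [abs_one]
      exact ⟨hB.1.pow k, hB.2.pow k⟩
    rw [hd.circleAverage, h0]
    simp [zero_pow_eq]
  obtain ⟨k, rfl | rfl⟩ := n.eq_nat_or_neg
  · simpa using key k
  · have : ∀ x, ((φ x ^ (-(k : ℤ)) : Circle) : ℂ) = starRingEnd ℂ ((φ x ^ k : Circle) : ℂ) := by
      intro x
      rw [← Circle.coe_inv_eq_conj, zpow_neg, zpow_natCast]
    simp only [this]
    rw [integral_conj, key]
    split_ifs <;> simp_all

/-- A self-map of the circle which extends to a holomorphic self-map of the disc fixing the
origin preserves arc length. -/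
lemma measurePreserving_of_diffContOnCl {B : ℂ → ℂ} (hB : DiffContOnCl ℂ B (Metric.ball 0 1))
    (h0 : B 0 = 0) {φ : Circle → Circle} (hφ : ∀ x : Circle, (φ x : ℂ) = B x) :
    MeasurePreserving φ arc arc := by
  have hφc : Continuous φ := by
    refine Continuous.subtype_mk (f := fun x : Circle => (φ x : ℂ)) ?_ (fun x => (φ x).2)
    simp_rw [hφ]
    refine hB.continuousOn_ball.comp_continuous continuous_circle_coe fun x => ?_
    simpa using x.norm_coe.le
  refine ⟨hφc.measurable, ?_⟩
  have := Measure.isProbabilityMeasure_map (μ := arc) hφc.measurable.aemeasurable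
  refine circle_measure_ext fun n => ?_
  have hn : Continuous fun x : Circle => ((x ^ n : Circle) : ℂ) :=
    continuous_circle_coe.comp (continuous_zpow n)
  rw [integral_map hφc.measurable.aemeasurable hn.aestronglyMeasurable,
    integral_zpow_comp_arc hB h0 hφc hφ]
  exact (integral_zpow_comp_arc (B := id) differentiable_id.diffContOnCl rfl continuous_id
    (fun _ => rfl) n).symm

lemma measurePreserving_inv_arc : MeasurePreserving (fun x : Circle => x⁻¹) arc arc := by
  have hc : Continuous fun x : Circle => x⁻¹ := continuous_inv
  refine ⟨hc.measurable, ?_⟩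
  have := Measure.isProbabilityMeasure_map (μ := arc) hc.measurable.aemeasurable
  refine circle_measure_ext fun n => ?_
  have hn : Continuous fun x : Circle => ((x ^ n : Circle) : ℂ) :=
    continuous_circle_coe.comp (continuous_zpow n)
  have key := integral_zpow_comp_arc (B := id) differentiable_id.diffContOnCl rfl continuous_id
    (fun _ => rfl)
  rw [integral_map hc.measurable.aemeasurable hn.aestronglyMeasurable]
  simp only [inv_zpow']
  simpa using (key (-n)).trans (by simpa using (key n).symm)

lemma measurePreserving_neg_arc : MeasurePreserving (fun x : Circle => -x) arc arc :=
  measurePreserving_of_diffContOnCl (B := fun z => -z) differentiable_neg.diffContOnCl (by simp)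
    (fun _ => rfl)

lemma measurePreserving_pow_arc {n : ℕ} (hn : n ≠ 0) :
    MeasurePreserving (fun x : Circle => x ^ n) arc arc :=
  measurePreserving_of_diffContOnCl (B := fun z => z ^ n) (differentiable_pow n).diffContOnCl
    (by simp [hn]) (fun _ => rfl)

/-! ### Integrability of `log |P|` on the torus. -/

instance instNullSingletonClassArc : NullSingletonClass arc := by
  refine ⟨fun x => ?_⟩
  have h : (Circle.exp ⁻¹' {x}).Countable := by
    refine (Set.countable_range fun m : ℤ => Complex.arg x + m * (2 * Real.pi)).mono fun θ hθ => ?_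
    have h1 : Circle.exp θ = Circle.exp (Complex.arg x) := by
      rw [Circle.exp_arg]; exact hθ
    obtain ⟨m, hm⟩ := Circle.exp_eq_exp.1 h1
    exact ⟨m, hm.symm⟩
  rw [arc, Measure.smul_apply, Measure.map_apply measurable_circleExp (measurableSet_singleton x),
    (h.measure_zero _), smul_zero]

/-- Adding one variable in front. -/
lemma measurePreserving_cons (n : ℕ) :
    MeasurePreserving (fun q : (Fin n → Circle) × Circle =>
      (Fin.cons q.2 q.1 : Fin (n + 1) → Circle)) ((torus n).prod arc) (torus (n + 1)) := by
  have h := (measurePreserving_piFinSuccAbove (fun _ : Fin (n + 1) => arc) 0).symm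
  have h2 := h.comp (Measure.measurePreserving_swap (μ := torus n) (ν := arc))
  convert h2 using 1
  ext q
  simp [MeasurableEquiv.piFinSuccAbove]

lemma exists_forall_norm_eval_le {n : ℕ} (p : MvPolynomial (Fin n) ℂ) :
    ∃ C : ℝ, 1 ≤ C ∧ ∀ x : Fin n → Circle, ‖MvPolynomial.eval (toC x) p‖ ≤ C := by
  have hc : Continuous fun x : Fin n → Circle => MvPolynomial.eval (toC x) p :=
    p.continuous_eval.comp continuous_toC
  obtain ⟨C, hC⟩ := (isCompact_range hc).isBounded.exists_norm_le
  exact ⟨max C 1, le_max_right _ _, fun x => (hC _ ⟨x, rfl⟩).trans (le_max_left _ _)⟩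

lemma measurable_eval_polynomial (p : Polynomial ℂ) :
    Measurable fun x : Circle => Real.log ‖p.eval (x : ℂ)‖ :=
  Real.measurable_log.comp (p.continuous.comp continuous_circle_coe).measurable.norm

lemma integrable_log_norm_polynomial (p : Polynomial ℂ) :
    Integrable (fun x : Circle => Real.log ‖p.eval (x : ℂ)‖) arc := by
  rw [integrable_arc_iff (f := fun z => Real.log ‖p.eval z‖)
    (measurable_eval_polynomial p).aestronglyMeasurable]
  exact p.intervalIntegrable_mahlerMeasure

lemma integral_log_norm_polynomial (p : Polynomial ℂ) :
    ∫ x : Circle, Real.log ‖p.eval (x : ℂ)‖ ∂arc = p.logMahlerMeasure :=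
  integral_arc (f := fun z => Real.log ‖p.eval z‖)
    (measurable_eval_polynomial p).aestronglyMeasurable

lemma log_norm_leadingCoeff_le_integral {p : Polynomial ℂ} (hp : p ≠ 0) :
    Real.log ‖p.leadingCoeff‖ ≤ ∫ x : Circle, Real.log ‖p.eval (x : ℂ)‖ ∂arc := by
  rw [integral_log_norm_polynomial, Polynomial.logMahlerMeasure_eq_log_MahlerMeasure]
  exact Real.log_le_log (by simpa using hp) p.leadingCoeff_le_mahlerMeasure

lemma ae_eval_polynomial_ne_zero {p : Polynomial ℂ} (hp : p ≠ 0) :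
    ∀ᵐ x : Circle ∂arc, p.eval (x : ℂ) ≠ 0 := by
  have : ((fun x : Circle => (x : ℂ)) ⁻¹' {z | p.IsRoot z}).Finite :=
    (Polynomial.finite_setOfPred_isRoot hp).preimage Circle.coe_injective.injOn
  rw [ae_iff]
  simpa using this.measure_zero arc

/-- The logarithm of a nonzero polynomial is integrable on the torus, and the polynomial vanishes
almost nowhere. -/
theorem ae_ne_zero_and_integrable_log {n : ℕ} {p : MvPolynomial (Fin n) ℂ} (hp : p ≠ 0) :
    (∀ᵐ x ∂torus n, MvPolynomial.eval (toC x) p ≠ 0) ∧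
      Integrable (fun x => Real.log ‖MvPolynomial.eval (toC x) p‖) (torus n) := by
  induction n with
  | zero =>
    obtain ⟨c, rfl⟩ := MvPolynomial.C_surjective (Fin 0) p
    have hc : c ≠ 0 := by rintro rfl; simp at hp
    simp [hc]
  | succ n ih =>
    -- View `p` as a polynomial in its first variable; the induction hypothesis is applied to the
    -- leading coefficient, a polynomial in the remaining ones.
    set q := MvPolynomial.finSuccEquiv ℂ n p with hq
    have hq0 : q ≠ 0 := by simpa [hq] using hp
    obtain ⟨h1, h2⟩ := ih (Polynomial.leadingCoeff_ne_zero.2 hq0)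
    have hev : ∀ z : (Fin n → Circle) × Circle,
        MvPolynomial.eval (toC (Fin.cons z.2 z.1 : Fin (n + 1) → Circle)) p =
          (q.map (MvPolynomial.eval (toC z.1))).eval (z.2 : ℂ) := by
      intro z
      rw [hq, ← MvPolynomial.eval_eq_eval_mv_eval']
      congr 1
      congr 1
      ext i
      refine Fin.cases ?_ (fun j => ?_) i <;> simp [toC]
    have hlc : ∀ x : Fin n → Circle,
        MvPolynomial.eval (toC x) q.leadingCoeff ≠ 0 →
        (q.map (MvPolynomial.eval (toC x))) ≠ 0 ∧
        (q.map (MvPolynomial.eval (toC x))).leadingCoeff =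
          MvPolynomial.eval (toC x) q.leadingCoeff := by
      intro x hx
      refine ⟨fun h => hx ?_, Polynomial.leadingCoeff_map_of_leadingCoeff_ne_zero _ hx⟩
      rw [← Polynomial.leadingCoeff_map_of_leadingCoeff_ne_zero _ hx, h,
        Polynomial.leadingCoeff_zero]
    have hmp := measurePreserving_cons n
    have hms : MeasurableSet
        {x : Fin (n + 1) → Circle | MvPolynomial.eval (toC x) p ≠ 0} :=
      ((measurable_eval_mvPolynomial p) (measurableSet_singleton 0)).compl
    have hm : Measurable fun z : (Fin n → Circle) × Circle =>
        Real.log ‖(q.map (MvPolynomial.eval (toC z.1))).eval (z.2 : ℂ)‖ := by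
      simp_rw [← hev]
      exact Real.measurable_log.comp ((measurable_eval_mvPolynomial p).comp hmp.measurable).norm
    constructor
    · rw [← hmp.map_eq, ae_map_iff hmp.measurable.aemeasurable hms]
      refine (Measure.ae_prod_iff_ae_ae (hmp.measurable hms)).2 ?_
      filter_upwards [h1] with x hx
      filter_upwards [ae_eval_polynomial_ne_zero (hlc x hx).1] with y hy
      rwa [hev (x, y)]
    · refine (hmp.integrable_comp
        (g := fun x => Real.log ‖MvPolynomial.eval (toC x) p‖)
        (Real.measurable_log.comp (measurable_eval_mvPolynomial p).norm).aestronglyMeasurable).1 ?_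
      simp only [Function.comp_def, hev]
      obtain ⟨C, hC1, hC⟩ := exists_forall_norm_eval_le p
      rw [integrable_prod_iff hm.aestronglyMeasurable]
      refine ⟨.of_forall fun x => integrable_log_norm_polynomial
        (q.map (MvPolynomial.eval (toC x))), ?_⟩
      refine Integrable.mono' ((integrable_const (2 * Real.log C)).sub h2)
        (hm.norm.stronglyMeasurable.integral_prod_right').aestronglyMeasurable ?_
      filter_upwards [h1] with x hx
      have hi := integrable_log_norm_polynomial (q.map (MvPolynomial.eval (toC x)))
      rw [Real.norm_of_nonneg (integral_nonneg fun _ => norm_nonneg _)]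
      -- If `u ≤ M` and `0 ≤ M` then `|u| ≤ 2 M - u`, so an upper bound for `log |p|` and a lower
      -- bound for its mean control the mean of its absolute value. `1 ≤ C` also covers `log 0 = 0`.
      have hle : ∀ y : Circle, ‖Real.log ‖(q.map (MvPolynomial.eval (toC x))).eval (y : ℂ)‖‖ ≤
          2 * Real.log C - Real.log ‖(q.map (MvPolynomial.eval (toC x))).eval (y : ℂ)‖ := by
        intro y
        have h3 := hC (Fin.cons y x)
        rw [hev (x, y)] at h3
        have h4 : Real.log ‖(q.map (MvPolynomial.eval (toC x))).eval (y : ℂ)‖ ≤ Real.log C := by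
          rcases (norm_nonneg ((q.map (MvPolynomial.eval (toC x))).eval (y : ℂ))).eq_or_lt with h | h
          · rw [← h, Real.log_zero]; exact Real.log_nonneg hC1
          · exact Real.log_le_log h h3
        have h5 := Real.log_nonneg hC1
        rw [Real.norm_eq_abs, abs_le]
        constructor <;> linarith
      calc _ ≤ ∫ y : Circle, (2 * Real.log C -
            Real.log ‖(q.map (MvPolynomial.eval (toC x))).eval (y : ℂ)‖) ∂arc :=
            integral_mono hi.norm ((integrable_const _).sub hi) hle
        _ = 2 * Real.log C -
            ∫ y : Circle, Real.log ‖(q.map (MvPolynomial.eval (toC x))).eval (y : ℂ)‖ ∂arc := by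
            rw [integral_sub (integrable_const _) hi]; simp
        _ ≤ _ := by
            -- The Mahler measure of a one-variable polynomial is at least that of its leading
            -- coefficient, whose logarithm is integrable by induction.
            have := log_norm_leadingCoeff_le_integral (hlc x hx).1
            rw [(hlc x hx).2] at this
            simp only [Pi.sub_apply]
            linarith

lemma ae_eval_ne_zero {n : ℕ} {p : MvPolynomial (Fin n) ℂ} (hp : p ≠ 0) :
    ∀ᵐ x ∂torus n, MvPolynomial.eval (toC x) p ≠ 0 :=
  (ae_ne_zero_and_integrable_log hp).1

lemma den_ne_zero {n : ℕ} (P : RatFun n) :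
    (IsFractionRing.den (MvPolynomial (Fin n) ℂ) P : MvPolynomial (Fin n) ℂ) ≠ 0 :=
  nonZeroDivisors.coe_ne_zero _

/-- The integral defining the Mahler measure of a rational function always converges. -/
theorem hasMahlerMeasure {n : ℕ} (P : RatFun n) : HasMahlerMeasure P := by
  rw [hasMahlerMeasure_iff]
  have hd := ae_ne_zero_and_integrable_log (den_ne_zero P)
  by_cases h0 : IsFractionRing.num (MvPolynomial (Fin n) ℂ) P = 0
  · simp [RatFun.eval, h0]
  · have hn := ae_ne_zero_and_integrable_log h0
    refine (hn.2.sub hd.2).congr ?_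
    filter_upwards [hn.1, hd.1] with x h1 h2
    rw [RatFun.eval, norm_div, Real.log_div (norm_ne_zero_iff.2 h1) (norm_ne_zero_iff.2 h2)]
    rfl

/-! ### Almost everywhere evaluation of rational functions. -/

/-- `Rep P f`: the values of `P` on the torus are almost everywhere those of `f`. -/
def Rep {n : ℕ} (P : RatFun n) (f : (Fin n → Circle) → ℂ) : Prop :=
  ∀ᵐ x ∂torus n, P.eval (toC x) = f x

/-- `RatFun.eval` uses the reduced fraction, so it respects field operations only where the
denominators involved do not vanish. Their zero sets are null, and elsewhere cross-multiplication
shows that any fraction representing `P` gives the same value. -/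
lemma rep_div_of_eq {n : ℕ} {P : RatFun n} {N D : MvPolynomial (Fin n) ℂ} (hD : D ≠ 0)
    (h : P = algebraMap _ (RatFun n) N / algebraMap _ (RatFun n) D) :
    Rep P fun x => MvPolynomial.eval (toC x) N / MvPolynomial.eval (toC x) D := by
  have hD' : algebraMap _ (RatFun n) D ≠ 0 := by simpa using hD
  have hd' : algebraMap _ (RatFun n)
      (IsFractionRing.den (MvPolynomial (Fin n) ℂ) P : MvPolynomial (Fin n) ℂ) ≠ 0 := by
    simp
  have hP : IsFractionRing.num (MvPolynomial (Fin n) ℂ) P * D =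
      N * (IsFractionRing.den (MvPolynomial (Fin n) ℂ) P : MvPolynomial (Fin n) ℂ) := by
    apply IsFractionRing.injective (MvPolynomial (Fin n) ℂ) (RatFun n)
    rw [map_mul, map_mul, ← div_eq_div_iff hd' hD', ← h]
    have := IsFractionRing.mk'_num_den (MvPolynomial (Fin n) ℂ) P
    rwa [IsFractionRing.mk'_eq_div] at this
  filter_upwards [ae_eval_ne_zero hD, ae_eval_ne_zero (den_ne_zero P)] with x h1 h2
  rw [RatFun.eval, div_eq_div_iff h2 h1, ← map_mul, hP, map_mul]

lemma eq_num_div_den {n : ℕ} (P : RatFun n) :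
    P = algebraMap _ (RatFun n) (IsFractionRing.num (MvPolynomial (Fin n) ℂ) P) /
      algebraMap _ (RatFun n)
        (IsFractionRing.den (MvPolynomial (Fin n) ℂ) P : MvPolynomial (Fin n) ℂ) := by
  have := IsFractionRing.mk'_num_den (MvPolynomial (Fin n) ℂ) P
  rw [IsFractionRing.mk'_eq_div] at this
  exact this.symm

section

variable {n : ℕ} {P Q : RatFun n} {f g : (Fin n → Circle) → ℂ}

lemma Rep.add (hP : Rep P f) (hQ : Rep Q g) : Rep (P + Q) fun x => f x + g x := by
  have h := rep_div_of_eq (P := P + Q)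
    (N := IsFractionRing.num (MvPolynomial (Fin n) ℂ) P * (IsFractionRing.den (MvPolynomial (Fin n) ℂ) Q) +
      (IsFractionRing.den (MvPolynomial (Fin n) ℂ) P) * IsFractionRing.num (MvPolynomial (Fin n) ℂ) Q)
    (mul_ne_zero (den_ne_zero P) (den_ne_zero Q)) (by
      conv_lhs => rw [eq_num_div_den P, eq_num_div_den Q]
      rw [div_add_div _ _ (by simp) (by simp)]
      simp only [map_add, map_mul])
  filter_upwards [h, hP, hQ, ae_eval_ne_zero (den_ne_zero P), ae_eval_ne_zero (den_ne_zero Q)]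
    with x h h1 h2 h3 h4
  rw [h, ← h1, ← h2, RatFun.eval, RatFun.eval, div_add_div _ _ h3 h4]
  simp only [map_add, map_mul]

lemma Rep.mul (hP : Rep P f) (hQ : Rep Q g) : Rep (P * Q) fun x => f x * g x := by
  have h := rep_div_of_eq (P := P * Q)
    (N := IsFractionRing.num (MvPolynomial (Fin n) ℂ) P * IsFractionRing.num (MvPolynomial (Fin n) ℂ) Q)
    (mul_ne_zero (den_ne_zero P) (den_ne_zero Q)) (by
      conv_lhs => rw [eq_num_div_den P, eq_num_div_den Q]
      rw [div_mul_div_comm]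
      simp only [map_mul])
  filter_upwards [h, hP, hQ] with x h h1 h2
  rw [h, ← h1, ← h2, RatFun.eval, RatFun.eval, div_mul_div_comm]
  simp only [map_mul]

lemma rep_algebraMap (p : MvPolynomial (Fin n) ℂ) :
    Rep (algebraMap _ (RatFun n) p) fun x => MvPolynomial.eval (toC x) p := by
  simpa using rep_div_of_eq (P := algebraMap _ (RatFun n) p) one_ne_zero (by simp)

lemma rep_one : Rep (1 : RatFun n) fun _ => 1 := by
  simpa using rep_algebraMap (n := n) 1

lemma rep_var (i : Fin n) : Rep (var i) fun x => (x i : ℂ) := by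
  simpa [toC, var] using rep_algebraMap (MvPolynomial.X i)

lemma Rep.neg (hP : Rep P f) : Rep (-P) fun x => -f x := by
  simpa using (rep_algebraMap (n := n) (-1)).mul hP

lemma Rep.sub (hP : Rep P f) (hQ : Rep Q g) : Rep (P - Q) fun x => f x - g x := by
  simpa [sub_eq_add_neg] using hP.add hQ.neg

lemma Rep.inv (hP : Rep P f) : Rep P⁻¹ fun x => (f x)⁻¹ := by
  by_cases h0 : IsFractionRing.num (MvPolynomial (Fin n) ℂ) P = 0
  · have hP0 : P = 0 := by rw [eq_num_div_den P, h0]; simp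
    filter_upwards [hP] with x h
    rw [← h, hP0, inv_zero]
    simp [RatFun.eval]
  · have h := rep_div_of_eq (P := P⁻¹) h0 (by
      conv_lhs => rw [eq_num_div_den P, inv_div])
    filter_upwards [h, hP] with x h h1
    rw [h, ← h1, RatFun.eval, inv_div]

lemma Rep.div (hP : Rep P f) (hQ : Rep Q g) : Rep (P / Q) fun x => f x / g x := by
  simpa [div_eq_mul_inv] using hP.mul hQ.inv

lemma Rep.pow (hP : Rep P f) (k : ℕ) : Rep (P ^ k) fun x => f x ^ k := by
  induction k with
  | zero => simpa using rep_one
  | succ k ih => simpa [pow_succ] using ih.mul hP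

lemma Rep.prod {ι : Type*} (s : Finset ι) {P : ι → RatFun n} {f : ι → (Fin n → Circle) → ℂ}
    (h : ∀ i ∈ s, Rep (P i) (f i)) : Rep (∏ i ∈ s, P i) fun x => ∏ i ∈ s, f i x := by
  classical
  induction s using Finset.induction_on with
  | empty => simpa using rep_one
  | insert a s ha ih =>
    simp only [Finset.prod_insert ha]
    exact (h a (by simp)).mul (ih fun i hi => h i (by simp [hi]))

lemma Rep.mahlerMeasure_eq (hP : Rep P f) :
    mahlerMeasure P = ∫ x, Real.log ‖f x‖ ∂torus n := by
  rw [MahlerInv.mahlerMeasure_eq]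
  refine integral_congr_ae ?_
  filter_upwards [hP] with x hx
  rw [hx]

lemma Rep.integrable (hP : Rep P f) : Integrable (fun x => Real.log ‖f x‖) (torus n) := by
  refine ((hasMahlerMeasure_iff P).1 (hasMahlerMeasure P)).congr ?_
  filter_upwards [hP] with x hx
  rw [hx]

end

lemma Rep.mahlerMeasure_congr {n m : ℕ} {P : RatFun n} {Q : RatFun m}
    {f : (Fin n → Circle) → ℂ} {g : (Fin m → Circle) → ℂ} (hP : Rep P f) (hQ : Rep Q g)
    {ψ : (Fin m → Circle) → (Fin n → Circle)} (hψ : MeasurePreserving ψ (torus m) (torus n))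
    (h : ∀ x, g x = f (ψ x)) : mahlerMeasure Q = mahlerMeasure P := by
  rw [hP.mahlerMeasure_eq, hQ.mahlerMeasure_eq, ← hψ.map_eq,
    integral_map hψ.measurable.aemeasurable]
  · simp only [h]
  · rw [hψ.map_eq]
    exact hP.integrable.aestronglyMeasurable

/-! ### Blaschke products and the Cayley transform. -/

/-- If `(a + b) / (a - b)` is a Blaschke product vanishing at the origin, then `b / a` is obtained
from `(1 - x) / (1 + x)` by a measure preserving substitution. -/
lemma exists_measurePreserving_of_blaschke {a b : ℂ → ℂ} (ha : Differentiable ℂ a)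
    (hb : Differentiable ℂ b) (hq : ∀ z, ‖z‖ ≤ 1 → a z - b z ≠ 0) (h0 : a 0 + b 0 = 0) {d : ℕ}
    (hd : ∀ x : Circle, a x + b x = (x : ℂ) ^ d * starRingEnd ℂ (a x - b x)) :
    ∃ φ : Circle → Circle, MeasurePreserving φ arc arc ∧
      ∀ x : Circle, (1 - (φ x : ℂ)) / (1 + φ x) = b x / a x := by
  have hnorm : ∀ x : Circle, ‖a x + b x‖ = ‖a x - b x‖ := fun x => by
    rw [hd, norm_mul, norm_pow, Circle.norm_coe, one_pow, one_mul, RCLike.norm_conj]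
  have hq' : ∀ x : Circle, a x - b x ≠ 0 := fun x => hq x x.norm_coe.le
  have hr : ∀ x : Circle, a x + b x ≠ 0 := fun x => by
    rw [← norm_ne_zero_iff, hnorm, norm_ne_zero_iff]; exact hq' x
  let β : Circle → Circle := fun x => ⟨(a x + b x) / (a x - b x), by
    refine mem_sphere_zero_iff_norm.2 ?_
    rw [norm_div, hnorm, div_self (norm_ne_zero_iff.2 (hq' x))]⟩
  have hβ : MeasurePreserving β arc arc := by
    refine measurePreserving_of_diffContOnCl (B := fun z => (a z + b z) / (a z - b z)) ?_
      (by simp [h0]) (fun _ => rfl)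
    refine ⟨?_, ?_⟩
    · exact (ha.add hb).differentiableOn.div (ha.sub hb).differentiableOn
        fun z hz => hq z (by simpa using (Metric.mem_ball.1 hz).le)
    · exact (ha.add hb).continuous.continuousOn.div (ha.sub hb).continuous.continuousOn
        fun z hz => hq z (by simpa using Metric.closure_ball_subset_closedBall hz)
  -- The Cayley transform of `β` is `-b / a`; inverting `β` corrects the sign.
  refine ⟨fun x => (β x)⁻¹, measurePreserving_inv_arc.comp hβ, fun x => ?_⟩
  have h1 : (((β x)⁻¹ : Circle) : ℂ) = (a x - b x) / (a x + b x) := by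
    rw [Circle.coe_inv]
    exact inv_div _ _
  have h2 := hr x
  rw [h1, one_sub_div h2, one_add_div h2, div_div_div_cancel_right₀ h2,
    show a x + b x - (a x - b x) = 2 * b x by ring, show a x + b x + (a x - b x) = 2 * a x by ring,
    mul_div_mul_left _ _ two_ne_zero]

/-- The Blaschke product is `z (2z + 1) / (z + 2)`. -/
lemma exists_measurePreserving_quadratic : ∃ φ : Circle → Circle, MeasurePreserving φ arc arc ∧
    ∀ x : Circle, (1 - (φ x : ℂ)) / (1 + φ x) = ((x : ℂ) ^ 2 - 1) / ((x : ℂ) ^ 2 + x + 1) := by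
  refine exists_measurePreserving_of_blaschke (a := fun z => z ^ 2 + z + 1) (b := fun z => z ^ 2 - 1)
    (d := 2) (by fun_prop) (by fun_prop) (fun z hz h => ?_) (by simp) (fun x => ?_)
  · have : z = -2 := by linear_combination h
    norm_num [this] at hz
  · have hx : (x : ℂ) ≠ 0 := x.coe_ne_zero
    simp only [map_sub, map_add, map_pow, map_one, ← Circle.coe_inv_eq_conj, Circle.coe_inv]
    field_simp
    ring

/-- The Blaschke product is `z² (2z² - 2z + 1) / (z² - 2z + 2)`; the poles `1 ± i` lie outside the
closed disc. -/
lemma exists_measurePreserving_quartic : ∃ φ : Circle → Circle, MeasurePreserving φ arc arc ∧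
    ∀ x : Circle, (1 - (φ x : ℂ)) / (1 + φ x) = ((x : ℂ) ^ 4 - (x : ℂ) ^ 3 + x - 1) /
      ((x : ℂ) ^ 4 - (x : ℂ) ^ 3 + (x : ℂ) ^ 2 - x + 1) := by
  refine exists_measurePreserving_of_blaschke (a := fun z => z ^ 4 - z ^ 3 + z ^ 2 - z + 1)
    (b := fun z => z ^ 4 - z ^ 3 + z - 1)
    (d := 4) (by fun_prop) (by fun_prop) (fun z hz h => ?_) (by simp) (fun x => ?_)
  · have h1 : (z - (1 + Complex.I)) * (z - (1 - Complex.I)) = 0 := by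
      linear_combination h - Complex.I_sq
    have h2 : Complex.normSq z ≤ 1 := by
      rw [Complex.normSq_eq_norm_sq]; exact pow_le_one₀ (norm_nonneg _) hz
    rcases mul_eq_zero.1 h1 with h | h <;> rw [sub_eq_zero.1 h, Complex.normSq_apply] at h2 <;>
      norm_num at h2
  · have hx : (x : ℂ) ≠ 0 := x.coe_ne_zero
    simp only [map_sub, map_add, map_pow, map_one, ← Circle.coe_inv_eq_conj, Circle.coe_inv]
    field_simp
    ring

/-- The Blaschke product is `z (2z⁴ + z³ + 1) / (z⁴ + z + 2)`. -/
lemma exists_measurePreserving_quintic : ∃ φ : Circle → Circle, MeasurePreserving φ arc arc ∧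
    ∀ x : Circle, (1 - (φ x : ℂ)) / (1 + φ x) = ((x : ℂ) ^ 5 - 1) /
      ((x : ℂ) ^ 5 + (x : ℂ) ^ 4 + x + 1) := by
  refine exists_measurePreserving_of_blaschke (a := fun z => z ^ 5 + z ^ 4 + z + 1)
    (b := fun z => z ^ 5 - 1)
    (d := 5) (by fun_prop) (by fun_prop) (fun z hz h => ?_) (by simp) (fun x => ?_)
  -- In the closed disc `Re z` and `Re z⁴` are at least `-1`, so a sum of `-2` forces `z = -1`,
  -- where `z⁴ + z = 0`.
  · have h1 : z ^ 4 + z = -2 := by linear_combination h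
    have h2 := congrArg Complex.re h1
    simp only [Complex.add_re, Complex.neg_re, Complex.re_ofNat] at h2
    have h3 : |z.re| ≤ 1 := (Complex.abs_re_le_norm z).trans hz
    have h4 : |(z ^ 4).re| ≤ 1 := (Complex.abs_re_le_norm _).trans (by
      rw [norm_pow]; exact pow_le_one₀ (norm_nonneg _) hz)
    have h5 : z.re = -1 := by linarith [(abs_le.1 h3).1, (abs_le.1 h4).1]
    have h6 : Complex.normSq z ≤ 1 := by
      rw [Complex.normSq_eq_norm_sq]; exact pow_le_one₀ (norm_nonneg _) hz
    rw [Complex.normSq_apply, h5] at h6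
    have h7 : z.im = 0 := by nlinarith
    have h8 : z = -1 := Complex.ext (by simp [h5]) (by simp [h7])
    norm_num [h8] at h1
  · have hx : (x : ℂ) ≠ 0 := x.coe_ne_zero
    simp only [map_sub, map_add, map_pow, map_one, ← Circle.coe_inv_eq_conj, Circle.coe_inv]
    field_simp
    ring

/-! ### Substitution in the first variable and the identities of (b). -/

/-- The function on the torus given by `factorProd`. -/
def prodFun {m n : ℕ} (ι : Fin m → Fin n) (x : Fin n → Circle) : ℂ :=
  ∏ i : Fin m, (1 - (x (ι i) : ℂ)) / (1 + x (ι i))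

/-- The function on the torus given by `factorProdTilde`. -/
def prodFunTilde {m n : ℕ} (ι : Fin m → Fin n) (x : Fin n → Circle) : ℂ :=
  ∏ i : Fin m, if (i : ℕ) = 0 then ((x (ι i) : ℂ) ^ 2 - 1) / ((x (ι i) : ℂ) ^ 2 + x (ι i) + 1)
    else (1 - (x (ι i) : ℂ)) / (1 + x (ι i))

lemma rep_factorProd {m n : ℕ} (ι : Fin m → Fin n) :
    Rep (factorProd fun i => var (ι i)) (prodFun ι) :=
  Rep.prod _ fun i _ => (rep_one.sub (rep_var (ι i))).div (rep_one.add (rep_var (ι i)))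

lemma rep_factorProdTilde {m n : ℕ} (ι : Fin m → Fin n) :
    Rep (factorProdTilde fun i => var (ι i)) (prodFunTilde ι) := by
  refine Rep.prod _ fun i _ => ?_
  have h := rep_var (ι i)
  split_ifs
  · exact ((h.pow 2).sub rep_one).div (((h.pow 2).add h).add rep_one)
  · exact (rep_one.sub h).div (rep_one.add h)

/-- Apply `φ` to the first coordinate. -/
def onFirst (φ : Circle → Circle) {n : ℕ} (x : Fin n → Circle) : Fin n → Circle :=
  fun i => (if (i : ℕ) = 0 then φ else id) (x i)

lemma measurePreserving_onFirst {φ : Circle → Circle} (hφ : MeasurePreserving φ arc arc) (n : ℕ) :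
    MeasurePreserving (onFirst φ) (torus n) (torus n) := by
  refine measurePreserving_pi (fun _ => arc) (fun _ => arc)
    (f := fun i : Fin n => if (i : ℕ) = 0 then φ else id) fun i => ?_
  split_ifs
  · exact hφ
  · exact MeasurePreserving.id _

lemma prodFunTilde_eq {m k : ℕ} {φ : Circle → Circle}
    (hφ : ∀ x : Circle, (1 - (φ x : ℂ)) / (1 + φ x) = ((x : ℂ) ^ 2 - 1) / ((x : ℂ) ^ 2 + x + 1))
    (x : Fin (m + k) → Circle) :
    prodFunTilde (Fin.castAdd k) x = prodFun (Fin.castAdd k) (onFirst φ x) := by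
  refine Finset.prod_congr rfl fun i _ => ?_
  by_cases h : (i : ℕ) = 0
  · simp [h, onFirst, hφ]
  · simp [h, onFirst]

/-- This is where `1 ≤ m` enters: the extra variables have index at least `m`, so none of them is
the variable that `φ` acts on. -/
lemma onFirst_natAdd {m k : ℕ} (hm : 1 ≤ m) (φ : Circle → Circle) (x : Fin (m + k) → Circle)
    (j : Fin k) : onFirst φ x (Fin.natAdd m j) = x (Fin.natAdd m j) := by
  have : ¬ (m + (j : ℕ) = 0) := by omega
  simp only [onFirst, Fin.val_natAdd, if_neg this, id]

lemma rep_S (m : ℕ) : Rep (S m) fun x => (1 + (x (Fin.natAdd m 0) : ℂ)) * x (Fin.natAdd m 2) +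
    prodFun (Fin.castAdd 3) x * (1 + (x (Fin.natAdd m 1) : ℂ)) :=
  ((rep_one.add (rep_var _)).mul (rep_var _)).add
    ((rep_factorProd _).mul (rep_one.add (rep_var _)))

lemma mahlerMeasure_RTilde {m : ℕ} (hm : 1 ≤ m) : mahlerMeasure (RTilde m) = mahlerMeasure (R m) := by
  obtain ⟨φ, hφ, h⟩ := exists_measurePreserving_quadratic
  refine Rep.mahlerMeasure_congr ((rep_var _).add (rep_factorProd _))
    ((rep_var _).add (rep_factorProdTilde _)) (measurePreserving_onFirst hφ _) fun x => ?_
  rw [prodFunTilde_eq h, onFirst_natAdd hm]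

lemma mahlerMeasure_STilde {m : ℕ} (hm : 1 ≤ m) : mahlerMeasure (STilde m) = mahlerMeasure (S m) := by
  obtain ⟨φ, hφ, h⟩ := exists_measurePreserving_quadratic
  refine Rep.mahlerMeasure_congr (rep_S m)
    (((rep_one.add (rep_var _)).mul (rep_var _)).add
      ((rep_factorProdTilde _).mul (rep_one.add (rep_var _))))
    (measurePreserving_onFirst hφ _) fun x => ?_
  rw [prodFunTilde_eq h, onFirst_natAdd hm, onFirst_natAdd hm, onFirst_natAdd hm]

lemma mahlerMeasure_TTilde {m : ℕ} (hm : 1 ≤ m) : mahlerMeasure (TTilde m) = mahlerMeasure (T m) := by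
  obtain ⟨φ, hφ, h⟩ := exists_measurePreserving_quadratic
  refine Rep.mahlerMeasure_congr
    ((rep_one.add ((rep_factorProd _).mul (rep_var _))).add
      ((rep_one.sub (rep_factorProd _)).mul (rep_var _)))
    ((rep_one.add ((rep_factorProdTilde _).mul (rep_var _))).add
      ((rep_one.sub (rep_factorProdTilde _)).mul (rep_var _)))
    (measurePreserving_onFirst hφ _) fun x => ?_
  rw [prodFunTilde_eq h, onFirst_natAdd hm, onFirst_natAdd hm]

/-! ### Reduction of the five-variable polynomials to `S 2`. -/

lemma measurePreserving_comp_perm {n : ℕ} (e : Equiv.Perm (Fin n)) :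
    MeasurePreserving (fun (x : Fin n → Circle) i => x (e i)) (torus n) (torus n) := by
  have h := measurePreserving_piCongrLeft (fun _ : Fin n => arc) e.symm
  convert h using 1
  ext x i
  have := MeasurableEquiv.piCongrLeft_apply_apply (β := fun _ => Circle) e.symm x (e i)
  rw [Equiv.symm_apply_apply] at this
  rw [this]

lemma Rep.ae_ne_zero {n : ℕ} {P : RatFun n} {f : (Fin n → Circle) → ℂ} (hP : Rep P f)
    (h0 : P ≠ 0) : ∀ᵐ x ∂torus n, f x ≠ 0 := by
  have hn : IsFractionRing.num (MvPolynomial (Fin n) ℂ) P ≠ 0 := by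
    intro h
    apply h0
    rw [eq_num_div_den P, h]
    simp
  filter_upwards [hP, ae_eval_ne_zero hn, ae_eval_ne_zero (den_ne_zero P)] with x h1 h2 h3
  rw [← h1, RatFun.eval]
  exact div_ne_zero h2 h3

lemma one_add_var_ne_zero {n : ℕ} (i : Fin n) : (1 : RatFun n) + var i ≠ 0 := by
  intro h
  have h1 : algebraMap (MvPolynomial (Fin n) ℂ) (RatFun n) (1 + MvPolynomial.X i) = 0 := by
    simpa [var] using h
  have h2 : (1 + MvPolynomial.X i : MvPolynomial (Fin n) ℂ) = 0 :=
    (IsFractionRing.injective (MvPolynomial (Fin n) ℂ) (RatFun n)) (h1.trans (map_zero _).symm)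
  simpa using congrArg (MvPolynomial.eval 0) h2

lemma S_two_ne_zero : S 2 ≠ 0 := by
  intro h
  have h0 := one_add_var_ne_zero (n := 5) 0
  have h1 := one_add_var_ne_zero (n := 5) 1
  have h2 : (1 + var 0) * (1 + var 1) * S 2 =
      (1 + var 0) * (1 + var 1) * ((1 + var 2) * var 4) +
        (1 - var 0) * (1 - var 1) * (1 + var 3) := by
    have : S 2 = (1 + var 2) * var 4 +
        (1 - var 0) / (1 + var 0) * ((1 - var 1) / (1 + var 1)) * (1 + var 3) := by
      rw [S, factorProd, Fin.prod_univ_two]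
      rfl
    rw [this]
    field_simp
  rw [h, mul_zero] at h2
  have h3 : algebraMap (MvPolynomial (Fin 5) ℂ) (RatFun 5)
      ((1 + MvPolynomial.X 0) * (1 + MvPolynomial.X 1) *
        ((1 + MvPolynomial.X 2) * MvPolynomial.X 4) +
        (1 - MvPolynomial.X 0) * (1 - MvPolynomial.X 1) * (1 + MvPolynomial.X 3)) = 0 := by
    simpa [var] using h2.symm
  have h4 := congrArg (MvPolynomial.eval 0)
    ((IsFractionRing.injective (MvPolynomial (Fin 5) ℂ) (RatFun 5)) (h3.trans (map_zero _).symm))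
  simp at h4

/-- The function on the torus given by `S 2`. -/
def sFun (x : Fin 5 → Circle) : ℂ :=
  (1 + (x 2 : ℂ)) * x 4 +
    (1 - (x 0 : ℂ)) / (1 + x 0) * ((1 - (x 1 : ℂ)) / (1 + x 1)) * (1 + (x 3 : ℂ))

lemma rep_S_two : Rep (S 2) sFun := by
  have h := rep_S 2
  convert h using 2 with x
  rw [sFun, prodFun, Fin.prod_univ_two]
  rfl

lemma integrable_log_norm_of_eq_eval {f : Circle → ℂ} (p : Polynomial ℂ)
    (h : ∀ x : Circle, f x = p.eval (x : ℂ)) : Integrable (fun x => Real.log ‖f x‖) arc := by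
  simp_rw [h]
  exact integrable_log_norm_polynomial p

lemma integrable_log_norm_one_add : Integrable (fun x : Circle => Real.log ‖1 + (x : ℂ)‖) arc :=
  integrable_log_norm_of_eq_eval (1 + Polynomial.X) fun x => by simp

lemma integral_log_norm_one_add : ∫ x : Circle, Real.log ‖1 + (x : ℂ)‖ ∂arc = 0 := by
  have h := integral_log_norm_polynomial (Polynomial.X + Polynomial.C 1)
  rw [Polynomial.logMahlerMeasure_X_add_C] at h
  simpa [add_comm] using h

lemma ae_one_add_ne_zero : ∀ᵐ x : Circle ∂arc, 1 + (x : ℂ) ≠ 0 := by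
  simpa [add_comm] using ae_eval_polynomial_ne_zero
    (Polynomial.X_add_C_ne_zero (1 : ℂ))

lemma integrable_coord {n : ℕ} {f : Circle → ℝ} (hf : Integrable f arc) (i : Fin n) :
    Integrable (fun x : Fin n → Circle => f (x i)) (torus n) :=
  (measurePreserving_eval (fun _ : Fin n => arc) i).integrable_comp_of_integrable hf

lemma integral_coord {n : ℕ} {f : Circle → ℝ} (hf : Integrable f arc) (i : Fin n) :
    ∫ x : Fin n → Circle, f (x i) ∂torus n = ∫ x, f x ∂arc := by
  have h := measurePreserving_eval (fun _ : Fin n => arc) i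
  conv_rhs => rw [← h.map_eq]
  rw [integral_map h.measurable.aemeasurable (by rw [h.map_eq]; exact hf.aestronglyMeasurable)]

lemma ae_coord {n : ℕ} {p : Circle → Prop} (hp : ∀ᵐ x ∂arc, p x) (i : Fin n) :
    ∀ᵐ x ∂torus n, p (x i) :=
  (measurePreserving_eval (fun _ : Fin n => arc) i).quasiMeasurePreserving.ae hp

/-- Almost everywhere, `fiveVar a b` factors as `α(x) (1 + w)` times `S 2` at the point `(φ(x), w,
u, y, z)`. The first two factors have mean logarithm zero, and the substitution in the third
preserves Haar measure. -/
lemma mahlerMeasure_fiveVar {a b : RatFun 5 → RatFun 5} {α β : Circle → ℂ} {φ : Circle → Circle}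
    (ha : Rep (a (var 0)) fun x => α (x 0)) (hb : Rep (b (var 0)) fun x => β (x 0))
    (hα : ∀ᵐ x ∂arc, α x ≠ 0) (hi : Integrable (fun x => Real.log ‖α x‖) arc)
    (h0 : ∫ x, Real.log ‖α x‖ ∂arc = 0) (hφ : MeasurePreserving φ arc arc)
    (h : ∀ x : Circle, (1 - (φ x : ℂ)) / (1 + φ x) = β x / α x) :
    mahlerMeasure (fiveVar a b) = mahlerMeasure (S 2) := by
  let e : Equiv.Perm (Fin 5) :=
    -- In the order `x, y, z, u, w`, the arguments `x, w, u, y, z` of `S 2` have indices `0, 4, 3,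
    -- 1, 2`.
    ⟨![0, 4, 3, 1, 2], ![0, 3, 4, 2, 1], by decide, by decide⟩
  have hψ : MeasurePreserving (fun x : Fin 5 → Circle => onFirst φ fun i => x (e i))
      (torus 5) (torus 5) := (measurePreserving_onFirst hφ 5).comp (measurePreserving_comp_perm e)
  have hrep : Rep (fiveVar a b) fun x : Fin 5 → Circle =>
      α (x 0) * (1 + (x 4 : ℂ)) * (1 + (x 3 : ℂ)) * x 2 +
        β (x 0) * (1 - (x 4 : ℂ)) * (1 + (x 1 : ℂ)) :=
    (((ha.mul (rep_one.add (rep_var 4))).mul (rep_one.add (rep_var 3))).mul (rep_var 2)).add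
      ((hb.mul (rep_one.sub (rep_var 4))).mul (rep_one.add (rep_var 1)))
  have hs : ∀ x : Fin 5 → Circle, sFun (onFirst φ fun i => x (e i)) =
      (1 + (x 3 : ℂ)) * x 2 +
        β (x 0) / α (x 0) * ((1 - (x 4 : ℂ)) / (1 + x 4)) * (1 + (x 1 : ℂ)) := by
    intro x
    rw [← h]
    rfl
  have hlog : AEStronglyMeasurable (fun x => Real.log ‖sFun x‖) (torus 5) :=
    rep_S_two.integrable.aestronglyMeasurable
  have hsi : Integrable (fun x : Fin 5 → Circle =>
      Real.log ‖sFun (onFirst φ fun i => x (e i))‖) (torus 5) :=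
    hψ.integrable_comp_of_integrable rep_S_two.integrable
  have hsI : ∫ x : Fin 5 → Circle, Real.log ‖sFun (onFirst φ fun i => x (e i))‖ ∂torus 5 =
      mahlerMeasure (S 2) := by
    rw [rep_S_two.mahlerMeasure_eq]
    conv_rhs => rw [← hψ.map_eq]
    rw [integral_map hψ.measurable.aemeasurable (by rw [hψ.map_eq]; exact hlog)]
  have hs0 : ∀ᵐ x : Fin 5 → Circle ∂torus 5, sFun (onFirst φ fun i => x (e i)) ≠ 0 :=
    hψ.quasiMeasurePreserving.ae (rep_S_two.ae_ne_zero S_two_ne_zero)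
  have hi0 := integrable_coord (n := 5) hi 0
  have hi4 := integrable_coord (n := 5) integrable_log_norm_one_add 4
  rw [hrep.mahlerMeasure_eq]
  calc _ = ∫ x : Fin 5 → Circle, (Real.log ‖α (x 0)‖ + Real.log ‖1 + (x 4 : ℂ)‖ +
        Real.log ‖sFun (onFirst φ fun i => x (e i))‖) ∂torus 5 := by
        refine integral_congr_ae ?_
        filter_upwards [hs0, ae_coord (n := 5) hα 0, ae_coord (n := 5) ae_one_add_ne_zero 4]
          with x h1 h2 h3
        rw [← Real.log_mul (norm_ne_zero_iff.2 h2) (norm_ne_zero_iff.2 h3), ← norm_mul,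
          ← Real.log_mul (norm_ne_zero_iff.2 (mul_ne_zero h2 h3)) (norm_ne_zero_iff.2 h1),
          ← norm_mul, hs]
        congr 2
        field_simp
    _ = _ := by
        rw [integral_add (f := fun x : Fin 5 → Circle =>
          Real.log ‖α (x 0)‖ + Real.log ‖1 + (x 4 : ℂ)‖) (hi0.add hi4) hsi, integral_add hi0 hi4, hsI,
          integral_coord (n := 5) hi 0, integral_coord (n := 5) integrable_log_norm_one_add 4,
          h0, integral_log_norm_one_add]
        ring

lemma integral_comp_measurePreserving {φ : Circle → Circle} (hφ : MeasurePreserving φ arc arc)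
    {f : Circle → ℝ} (hf : Integrable f arc) : ∫ x, f (φ x) ∂arc = ∫ x, f x ∂arc := by
  conv_rhs => rw [← hφ.map_eq]
  rw [integral_map hφ.measurable.aemeasurable (by rw [hφ.map_eq]; exact hf.aestronglyMeasurable)]

lemma integral_log_norm_one_add_comp {φ : Circle → Circle} (hφ : MeasurePreserving φ arc arc) :
    Integrable (fun x : Circle => Real.log ‖1 + (φ x : ℂ)‖) arc ∧
    ∫ x : Circle, Real.log ‖1 + (φ x : ℂ)‖ ∂arc = 0 ∧ ∀ᵐ x : Circle ∂arc, 1 + (φ x : ℂ) ≠ 0 :=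
  ⟨hφ.integrable_comp_of_integrable integrable_log_norm_one_add,
    (integral_comp_measurePreserving hφ integrable_log_norm_one_add).trans
      integral_log_norm_one_add, hφ.quasiMeasurePreserving.ae ae_one_add_ne_zero⟩

lemma integral_log_mul {f g : Circle → ℂ} (hf : ∀ᵐ x ∂arc, f x ≠ 0) (hg : ∀ᵐ x ∂arc, g x ≠ 0)
    (hfi : Integrable (fun x => Real.log ‖f x‖) arc)
    (hgi : Integrable (fun x => Real.log ‖g x‖) arc) :
    ∫ x, Real.log ‖f x * g x‖ ∂arc = ∫ x, Real.log ‖f x‖ ∂arc + ∫ x, Real.log ‖g x‖ ∂arc := by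
  rw [← integral_add hfi hgi]
  refine integral_congr_ae ?_
  filter_upwards [hf, hg] with x h1 h2
  rw [norm_mul, Real.log_mul (norm_ne_zero_iff.2 h1) (norm_ne_zero_iff.2 h2)]

/-- The leading factor has Mahler measure zero because `(1 - x)(x² + x + 1) = 1 - x³`. -/
lemma mahlerMeasure_P₁ : mahlerMeasure P₁ = mahlerMeasure (S 2) := by
  obtain ⟨φ, hφ, h⟩ := exists_measurePreserving_quadratic
  have hx := rep_var (n := 5) 0
  have hi : Integrable (fun x : Circle => Real.log ‖(x : ℂ) ^ 2 + x + 1‖) arc :=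
    integrable_log_norm_of_eq_eval (Polynomial.X ^ 2 + Polynomial.X + 1) fun x => by simp
  have h0 : ∀ᵐ x : Circle ∂arc, (x : ℂ) ^ 2 + x + 1 ≠ 0 := by
    have : (Polynomial.X ^ 2 + Polynomial.X + 1 : Polynomial ℂ) ≠ 0 := fun h => by
      simpa using congrArg (Polynomial.eval 0) h
    simpa using ae_eval_polynomial_ne_zero this
  refine mahlerMeasure_fiveVar (((hx.pow 2).add hx).add rep_one) ((hx.pow 2).sub rep_one)
    h0 hi ?_ hφ h
  obtain ⟨h1, h2, h3⟩ := integral_log_norm_one_add_comp measurePreserving_neg_arc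
  obtain ⟨-, h5, -⟩ := integral_log_norm_one_add_comp
    (measurePreserving_neg_arc.comp (measurePreserving_pow_arc (n := 3) (by norm_num)))
  have h7 := integral_log_mul h3 h0 h1 hi
  rw [h2, zero_add] at h7
  rw [← h7, ← h5]
  congr with x
  congr 2
  simp
  ring

/-- Here `(1 + x)(x⁴ - x³ + x² - x + 1) = 1 + x⁵`. -/
lemma mahlerMeasure_P₂ : mahlerMeasure P₂ = mahlerMeasure (S 2) := by
  obtain ⟨φ, hφ, h⟩ := exists_measurePreserving_quartic
  have hx := rep_var (n := 5) 0
  have hi : Integrable (fun x : Circle =>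
      Real.log ‖(x : ℂ) ^ 4 - (x : ℂ) ^ 3 + (x : ℂ) ^ 2 - x + 1‖) arc :=
    integrable_log_norm_of_eq_eval
      (Polynomial.X ^ 4 - Polynomial.X ^ 3 + Polynomial.X ^ 2 - Polynomial.X + 1) fun x => by simp
  have h0 : ∀ᵐ x : Circle ∂arc, (x : ℂ) ^ 4 - (x : ℂ) ^ 3 + (x : ℂ) ^ 2 - x + 1 ≠ 0 := by
    have : (Polynomial.X ^ 4 - Polynomial.X ^ 3 + Polynomial.X ^ 2 - Polynomial.X + 1 :
        Polynomial ℂ) ≠ 0 := fun h => by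
      simpa using congrArg (Polynomial.eval 0) h
    simpa using ae_eval_polynomial_ne_zero this
  refine mahlerMeasure_fiveVar
    (((((hx.pow 4).sub (hx.pow 3)).add (hx.pow 2)).sub hx).add rep_one)
    ((((hx.pow 4).sub (hx.pow 3)).add hx).sub rep_one) h0 hi ?_ hφ h
  obtain ⟨-, h5, -⟩ := integral_log_norm_one_add_comp (measurePreserving_pow_arc (n := 5) (by norm_num))
  have h7 := integral_log_mul ae_one_add_ne_zero h0 integrable_log_norm_one_add hi
  rw [integral_log_norm_one_add, zero_add] at h7
  rw [← h7, ← h5]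
  congr with x
  congr 2
  simp
  ring

/-- Here `x⁵ + x⁴ + x + 1 = (1 + x)(1 + x⁴)`. -/
lemma mahlerMeasure_P₃ : mahlerMeasure P₃ = mahlerMeasure (S 2) := by
  obtain ⟨φ, hφ, h⟩ := exists_measurePreserving_quintic
  have hx := rep_var (n := 5) 0
  have hi : Integrable (fun x : Circle =>
      Real.log ‖(x : ℂ) ^ 5 + (x : ℂ) ^ 4 + x + 1‖) arc :=
    integrable_log_norm_of_eq_eval
      (Polynomial.X ^ 5 + Polynomial.X ^ 4 + Polynomial.X + 1) fun x => by simp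
  have h0 : ∀ᵐ x : Circle ∂arc, (x : ℂ) ^ 5 + (x : ℂ) ^ 4 + x + 1 ≠ 0 := by
    have : (Polynomial.X ^ 5 + Polynomial.X ^ 4 + Polynomial.X + 1 :
        Polynomial ℂ) ≠ 0 := fun h => by
      simpa using congrArg (Polynomial.eval 0) h
    simpa using ae_eval_polynomial_ne_zero this
  refine mahlerMeasure_fiveVar ((((hx.pow 5).add (hx.pow 4)).add hx).add rep_one)
    ((hx.pow 5).sub rep_one) h0 hi ?_ hφ h
  obtain ⟨h1, h2, h3⟩ := integral_log_norm_one_add_comp (measurePreserving_pow_arc (n := 4) (by norm_num))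
  have h7 := integral_log_mul ae_one_add_ne_zero h3 integrable_log_norm_one_add h1
  rw [integral_log_norm_one_add, h2, zero_add] at h7
  rw [← h7]
  congr with x
  congr 2
  simp
  ring

/-! ### Single and double sums over odd numbers. -/

/-- The `k`-th odd number, as a real number. -/
def od (k : ℕ) : ℝ := 2 * k + 1

lemma od_pos (k : ℕ) : 0 < od k := by unfold od; positivity

lemma one_le_od (k : ℕ) : 1 ≤ od k := by
  unfold od
  have : (0 : ℝ) ≤ k := k.cast_nonneg
  linarith

lemma od_eq (k : ℕ) : od k = ((2 * k + 1 : ℕ) : ℝ) := by simp [od]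

lemma summable_od {s : ℕ} (hs : 2 ≤ s) : Summable fun k => 1 / od k ^ s := by
  have h := (Real.summable_one_div_nat_pow (p := s)).2 (by omega)
  have h2 := h.comp_injective (i := fun k : ℕ => 2 * k + 1) (fun a b hab => by simpa using hab)
  simpa [Function.comp_def, od_eq] using h2

lemma summable_od_mul : Summable fun z : ℕ × ℕ => 1 / od z.1 ^ 2 * (1 / od z.2 ^ 2) :=
  (summable_od le_rfl).mul_of_nonneg (summable_od le_rfl) (fun _ => by positivity)
    (fun _ => by positivity)

/-- The Fourier series of the second Bernoulli polynomial minus its even-index terms, which form a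
quarter of the same series at the doubled angle; that angle stays within one period because `θ ≤ π`.
-/
lemma hasSum_cos_od {θ : ℝ} (h0 : 0 ≤ θ) (h1 : θ ≤ Real.pi) :
    HasSum (fun k => 1 / od k ^ 2 * Real.cos (od k * θ)) (Real.pi ^ 2 / 8 - Real.pi * θ / 4) := by
  have hpi := Real.pi_pos
  have hB : ∀ x : ℝ, (Polynomial.map (algebraMap ℚ ℝ) (Polynomial.bernoulli (2 * 1))).eval x =
      x ^ 2 - x + 1 / 6 := by
    intro x
    simp only [Polynomial.bernoulli, mul_one, Finset.sum_range_succ, Finset.range_zero,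
      Finset.sum_empty, bernoulli_zero, bernoulli_one, bernoulli_two]
    simp
    ring
  have hall := hasSum_one_div_nat_pow_mul_cos one_ne_zero (x := θ / (2 * Real.pi))
    ⟨by positivity, by rw [div_le_one (by positivity)]; linarith⟩
  have heven := (hasSum_one_div_nat_pow_mul_cos one_ne_zero (x := θ / Real.pi)
    ⟨by positivity, by rw [div_le_one (by positivity)]; linarith⟩).mul_left (1 / 4)
  rw [hB] at hall heven
  set f : ℕ → ℝ := fun n => 1 / (n : ℝ) ^ (2 * 1) * Real.cos (2 * Real.pi * n * (θ / (2 * Real.pi)))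
    with hf
  have hfe : (fun n : ℕ => 1 / 4 * (1 / (n : ℝ) ^ (2 * 1) *
      Real.cos (2 * Real.pi * n * (θ / Real.pi)))) = fun k => f (2 * k) := by
    ext k
    have : 2 * Real.pi * ((2 * k : ℕ) : ℝ) * (θ / (2 * Real.pi)) =
        2 * Real.pi * k * (θ / Real.pi) := by
      push_cast; field_simp
    simp only [hf, this, mul_one]
    push_cast
    rw [mul_pow, one_div, one_div, one_div, mul_inv]
    ring
  rw [hfe] at heven
  have hfo : (fun k => f (2 * k + 1)) = fun k => 1 / od k ^ 2 * Real.cos (od k * θ) := by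
    ext k
    have : 2 * Real.pi * ((2 * k + 1 : ℕ) : ℝ) * (θ / (2 * Real.pi)) = od k * θ := by
      rw [od_eq]; field_simp
    simp only [hf, this, mul_one]
    rw [od_eq]
  have ho : Summable fun k => f (2 * k + 1) :=
    hall.summable.comp_injective (i := fun k : ℕ => 2 * k + 1) (fun a b hab => by simpa using hab)
  have hu := hall.unique (heven.even_add_odd ho.hasSum)
  rw [← hfo]
  convert ho.hasSum using 1
  rw [← sub_eq_iff_eq_add'.2 hu]
  simp [Nat.factorial]
  field_simp
  ring

lemma tsum_od_two : ∑' k, 1 / od k ^ 2 = Real.pi ^ 2 / 8 := by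
  simpa using (hasSum_cos_od le_rfl Real.pi_pos.le).tsum_eq

lemma cos_od_mul_pi (k : ℕ) : Real.cos (od k * Real.pi) = -1 := by
  rw [od, add_mul, one_mul, Real.cos_add_pi, show (2 * (k : ℝ)) * Real.pi = k * (2 * Real.pi) by ring,
    Real.cos_nat_mul_two_pi]

lemma sin_od_mul_pi (k : ℕ) : Real.sin (od k * Real.pi) = 0 := by
  rw [od_eq]; exact Real.sin_nat_mul_pi _

lemma integral_mul_sin_od_add (j k : ℕ) :
    ∫ θ in (0 : ℝ)..Real.pi, θ * Real.sin ((od j + od k) * θ) = -Real.pi / (od j + od k) := by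
  set s := od j + od k with hs
  have h0 : s ≠ 0 := (add_pos (od_pos j) (od_pos k)).ne'
  have hd : ∀ θ ∈ Set.uIcc 0 Real.pi, HasDerivAt
      (fun θ => -(θ * Real.cos (s * θ)) / s + Real.sin (s * θ) / s ^ 2)
      (θ * Real.sin (s * θ)) θ := by
    intro θ _
    have h1 : HasDerivAt (fun θ => s * θ) s θ := by simpa using (hasDerivAt_id θ).const_mul s
    have h2 := ((((hasDerivAt_id' θ).mul h1.cos).neg.div_const s).add (h1.sin.div_const (s ^ 2)))
    refine h2.congr_deriv ?_
    field_simp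
    ring
  rw [intervalIntegral.integral_eq_sub_of_hasDerivAt hd
    (by apply Continuous.intervalIntegrable; fun_prop)]
  have hc : Real.cos (s * Real.pi) = 1 := by
    rw [hs, add_mul, Real.cos_add, cos_od_mul_pi, cos_od_mul_pi, sin_od_mul_pi]; norm_num
  have hsn : Real.sin (s * Real.pi) = 0 := by
    rw [hs, add_mul, Real.sin_add, sin_od_mul_pi, sin_od_mul_pi]; norm_num
  rw [hc, hsn]
  simp

lemma integral_mul_linear_mul_sin_od (k : ℕ) :
    ∫ θ in (0 : ℝ)..Real.pi, θ * (Real.pi ^ 2 / 8 - Real.pi * θ / 4) * Real.sin (od k * θ) =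
      -Real.pi ^ 3 / (8 * od k) + Real.pi / od k ^ 3 := by
  set s := od k with hs
  have h0 : s ≠ 0 := (od_pos k).ne'
  have hd : ∀ θ ∈ Set.uIcc 0 Real.pi, HasDerivAt
      (fun θ => -(θ * (Real.pi ^ 2 / 8 - Real.pi * θ / 4) * Real.cos (s * θ)) / s +
        (Real.pi ^ 2 / 8 - Real.pi * θ / 2) * Real.sin (s * θ) / s ^ 2 -
        Real.pi / 2 * Real.cos (s * θ) / s ^ 3)
      (θ * (Real.pi ^ 2 / 8 - Real.pi * θ / 4) * Real.sin (s * θ)) θ := by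
    intro θ _
    have h1 : HasDerivAt (fun θ => s * θ) s θ := by simpa using (hasDerivAt_id θ).const_mul s
    have h3 : HasDerivAt (fun θ => Real.pi ^ 2 / 8 - Real.pi * θ / 4) (-(Real.pi / 4)) θ := by
      simpa using (((hasDerivAt_id θ).const_mul Real.pi).div_const 4).const_sub (Real.pi ^ 2 / 8)
    have h4 : HasDerivAt (fun θ => Real.pi ^ 2 / 8 - Real.pi * θ / 2) (-(Real.pi / 2)) θ := by
      simpa using (((hasDerivAt_id θ).const_mul Real.pi).div_const 2).const_sub (Real.pi ^ 2 / 8)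
    have h2 := (((((hasDerivAt_id' θ).mul h3).mul h1.cos).neg.div_const s).add
      ((h4.mul h1.sin).div_const (s ^ 2))).sub ((h1.cos.const_mul (Real.pi / 2)).div_const (s ^ 3))
    refine h2.congr_deriv ?_
    simp only [Pi.mul_apply]
    field_simp
    ring
  rw [intervalIntegral.integral_eq_sub_of_hasDerivAt hd
    (by apply Continuous.intervalIntegrable; fun_prop), hs, cos_od_mul_pi, sin_od_mul_pi, ← hs]
  simp
  field_simp
  ring

/-- `∫_0^π θ sin(aθ) cos(bθ) dθ` for odd `a`, `b`. -/
def sinCos (j k : ℕ) : ℝ :=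
  ∫ θ in (0 : ℝ)..Real.pi, θ * Real.sin (od j * θ) * Real.cos (od k * θ)

/-- Symmetrising turns the integrand into `θ sin ((a + b) θ)`; this produces the factor `1 / (a +
b)` of the Tornheim sum. -/
lemma sinCos_add (j k : ℕ) : sinCos j k + sinCos k j = -Real.pi / (od j + od k) := by
  rw [← integral_mul_sin_od_add, sinCos, sinCos, ← intervalIntegral.integral_add
    (by apply Continuous.intervalIntegrable; fun_prop)
    (by apply Continuous.intervalIntegrable; fun_prop)]
  congr with θ
  rw [add_mul, Real.sin_add]
  ring

lemma abs_sinCos_le (j k : ℕ) : |sinCos j k| ≤ Real.pi * Real.pi := by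
  have h := intervalIntegral.norm_integral_le_of_norm_le_const (a := 0) (b := Real.pi)
    (C := Real.pi) (f := fun θ => θ * Real.sin (od j * θ) * Real.cos (od k * θ)) (fun θ hθ => by
      rw [Set.uIoc_of_le Real.pi_pos.le] at hθ
      rw [norm_mul, norm_mul, Real.norm_eq_abs, Real.norm_eq_abs, Real.norm_eq_abs,
        abs_of_pos hθ.1]
      calc θ * |Real.sin (od j * θ)| * |Real.cos (od k * θ)| ≤ Real.pi * 1 * 1 := by
            gcongr
            · exact hθ.2
            · exact Real.abs_sin_le_one _
            · exact Real.abs_cos_le_one _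
        _ = Real.pi := by ring)
  simpa [sinCos, abs_of_pos Real.pi_pos] using h

/-- Multiply the series of `hasSum_cos_od` by `θ sin (aθ)` and integrate term by term, dominated by
`π / b²`. -/
lemma hasSum_sinCos (j : ℕ) : HasSum (fun k => 1 / od k ^ 2 * sinCos j k)
    (-Real.pi ^ 3 / (8 * od j) + Real.pi / od j ^ 3) := by
  have hpi := Real.pi_pos
  have h := intervalIntegral.hasSum_integral_of_dominated_convergence (μ := volume)
    (a := 0) (b := Real.pi) (ι := ℕ)
    (F := fun k θ => 1 / od k ^ 2 * (θ * Real.sin (od j * θ) * Real.cos (od k * θ)))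
    (f := fun θ => θ * (Real.pi ^ 2 / 8 - Real.pi * θ / 4) * Real.sin (od j * θ))
    (fun k _ => 1 / od k ^ 2 * Real.pi)
    (fun k => (by fun_prop : Continuous fun θ : ℝ => 1 / od k ^ 2 * (θ * Real.sin (od j * θ) *
      Real.cos (od k * θ))).aestronglyMeasurable)
    (fun k => .of_forall fun θ hθ => by
      rw [Set.uIoc_of_le hpi.le] at hθ
      have h1 : 0 ≤ 1 / od k ^ 2 := by positivity
      rw [norm_mul, norm_mul, norm_mul, Real.norm_of_nonneg h1, Real.norm_of_nonneg hθ.1.le]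
      have h2 : θ * |Real.sin (od j * θ)| * |Real.cos (od k * θ)| ≤ Real.pi * 1 * 1 := by
        gcongr
        · exact hθ.2
        · exact Real.abs_sin_le_one _
        · exact Real.abs_cos_le_one _
      rw [mul_one, mul_one] at h2
      exact mul_le_mul_of_nonneg_left h2 h1)
    (.of_forall fun θ _ => (summable_od le_rfl).mul_right _)
    (by simp)
    (.of_forall fun θ hθ => by
      rw [Set.uIoc_of_le hpi.le] at hθ
      convert! (hasSum_cos_od hθ.1.le hθ.2).mul_left (θ * Real.sin (od j * θ)) using 1
      · ext k; ring
      · ring)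
  simp only [intervalIntegral.integral_const_mul, integral_mul_linear_mul_sin_od] at h
  exact h

lemma summable_of_le_od_mul {f : ℕ × ℕ → ℝ} (C : ℝ)
    (h : ∀ z, |f z| ≤ C * (1 / od z.1 ^ 2 * (1 / od z.2 ^ 2))) : Summable f :=
  Summable.of_norm_bounded (summable_od_mul.mul_left C) h

lemma summable_tornheim :
    Summable fun z : ℕ × ℕ => 1 / (od z.1 ^ 2 * od z.2 ^ 2 * (od z.1 + od z.2)) := by
  refine summable_of_le_od_mul 1 fun z => ?_
  have h1 := od_pos z.1
  have h2 := od_pos z.2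
  rw [abs_of_pos (by positivity), one_mul, ← one_div_mul_one_div, ← one_div_mul_one_div]
  refine mul_le_of_le_one_right (by positivity) ?_
  rw [div_le_one (by positivity)]
  linarith [one_le_od z.1]

/-- By `sinCos_add` the sum is `-2/π` times the double sum of `sinCos / (a² b²)`, whose inner sum is
known from `hasSum_sinCos`. -/
lemma tsum_tornheim : ∑' z : ℕ × ℕ, 1 / (od z.1 ^ 2 * od z.2 ^ 2 * (od z.1 + od z.2)) =
    Real.pi ^ 2 / 4 * ∑' k, 1 / od k ^ 3 - 2 * ∑' k, 1 / od k ^ 5 := by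
  have hpi := Real.pi_pos
  have hsum : Summable fun z : ℕ × ℕ => 1 / od z.1 ^ 2 * (1 / od z.2 ^ 2 * sinCos z.1 z.2) := by
    refine summable_of_le_od_mul (Real.pi * Real.pi) fun z => ?_
    have h1 := od_pos z.1
    have h2 := od_pos z.2
    rw [← mul_assoc, abs_mul, abs_of_pos (by positivity), mul_comm]
    gcongr
    exact abs_sinCos_le _ _
  have hval : ∑' z : ℕ × ℕ, 1 / od z.1 ^ 2 * (1 / od z.2 ^ 2 * sinCos z.1 z.2) =
      -Real.pi ^ 3 / 8 * ∑' k, 1 / od k ^ 3 + Real.pi * ∑' k, 1 / od k ^ 5 := by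
    rw [hsum.tsum_prod, ← tsum_mul_left, ← tsum_mul_left,
      ← ((summable_od (by norm_num)).mul_left _).tsum_add ((summable_od (by norm_num)).mul_left _)]
    refine tsum_congr fun j => ?_
    refine (tsum_mul_left (a := 1 / od j ^ 2)).trans ?_
    rw [(hasSum_sinCos j).tsum_eq]
    have := od_pos j
    field_simp
  have hswap : ∑' z : ℕ × ℕ, 1 / od z.1 ^ 2 * (1 / od z.2 ^ 2 * sinCos z.1 z.2) =
      ∑' z : ℕ × ℕ, 1 / od z.2 ^ 2 * (1 / od z.1 ^ 2 * sinCos z.2 z.1) :=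
    ((Equiv.prodComm ℕ ℕ).tsum_eq _).symm
  have hsum' : Summable fun z : ℕ × ℕ => 1 / od z.2 ^ 2 * (1 / od z.1 ^ 2 * sinCos z.2 z.1) :=
    (Equiv.prodComm ℕ ℕ).summable_iff.2 hsum
  have h2 : ∑' z : ℕ × ℕ, 1 / (od z.1 ^ 2 * od z.2 ^ 2 * (od z.1 + od z.2)) =
      -(1 / Real.pi) * (∑' z : ℕ × ℕ, 1 / od z.1 ^ 2 * (1 / od z.2 ^ 2 * sinCos z.1 z.2) +
        ∑' z : ℕ × ℕ, 1 / od z.2 ^ 2 * (1 / od z.1 ^ 2 * sinCos z.2 z.1)) := by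
    rw [← hsum.tsum_add hsum', ← tsum_mul_left]
    refine tsum_congr fun z => ?_
    have h1 := od_pos z.1
    have h2 := od_pos z.2
    have h3 := sinCos_add z.1 z.2
    have h4 : sinCos z.1 z.2 = -Real.pi / (od z.1 + od z.2) - sinCos z.2 z.1 := by linarith
    rw [h4]
    field_simp
    ring
  rw [h2, ← hswap, hval]
  field_simp
  ring

/-- The double sum `∑ 1 / (a³ (a + b)²)` over odd positive `a`, `b`. -/
lemma hasSum_double : HasSum (fun z : ℕ × ℕ => 1 / (od z.1 ^ 3 * (od z.1 + od z.2) ^ 2))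
    (3 * ∑' k, 1 / od k ^ 5 - Real.pi ^ 2 / 4 * ∑' k, 1 / od k ^ 3) := by
  have hU : Summable fun z : ℕ × ℕ => 1 / (od z.1 ^ 3 * (od z.1 + od z.2) ^ 2) := by
    refine summable_of_le_od_mul 1 fun z => ?_
    have h1 := od_pos z.1
    have h2 := od_pos z.2
    rw [abs_of_pos (by positivity), one_mul, one_div_mul_one_div]
    refine one_div_le_one_div_of_le (by positivity) ?_
    gcongr
    · exact one_le_od _
    · norm_num
    · linarith
  have hV : Summable fun z : ℕ × ℕ => 1 / (od z.1 ^ 2 * od z.2 * (od z.1 + od z.2) ^ 2) := by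
    refine summable_of_le_od_mul 1 fun z => ?_
    have h1 := od_pos z.1
    have h2 := od_pos z.2
    rw [abs_of_pos (by positivity), one_mul, one_div_mul_one_div]
    refine one_div_le_one_div_of_le (by positivity) ?_
    rw [mul_assoc]
    gcongr
    calc od z.2 ^ 2 = 1 * od z.2 ^ 2 := (one_mul _).symm
      _ ≤ od z.2 * (od z.1 + od z.2) ^ 2 := by
        gcongr
        · exact one_le_od _
        · linarith
  have hV' : Summable fun z : ℕ × ℕ => 1 / (od z.2 ^ 2 * od z.1 * (od z.2 + od z.1) ^ 2) :=
    (Equiv.prodComm ℕ ℕ).summable_iff.2 hV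
  have hswap : ∑' z : ℕ × ℕ, 1 / (od z.1 ^ 2 * od z.2 * (od z.1 + od z.2) ^ 2) =
      ∑' z : ℕ × ℕ, 1 / (od z.2 ^ 2 * od z.1 * (od z.2 + od z.1) ^ 2) :=
    ((Equiv.prodComm ℕ ℕ).tsum_eq _).symm
  -- From `1/(a² b) + 1/(a b²) = (a + b)/(a² b²)`; with the symmetry `hswap` it says that twice the
  -- middle sum is the Tornheim sum.
  have hVT : ∑' z : ℕ × ℕ, 1 / (od z.1 ^ 2 * od z.2 * (od z.1 + od z.2) ^ 2) +
      ∑' z : ℕ × ℕ, 1 / (od z.2 ^ 2 * od z.1 * (od z.2 + od z.1) ^ 2) =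
      ∑' z : ℕ × ℕ, 1 / (od z.1 ^ 2 * od z.2 ^ 2 * (od z.1 + od z.2)) := by
    rw [← hV.tsum_add hV']
    refine tsum_congr fun z => ?_
    have h1 := od_pos z.1
    have h2 := od_pos z.2
    rw [add_comm (od z.2) (od z.1)]
    field_simp
    ring
  -- After clearing denominators this is `(a + b)² = b² + a b + a (a + b)`.
  have hprod : (∑' k, 1 / od k ^ 3) * ∑' k, 1 / od k ^ 2 =
      ∑' z : ℕ × ℕ, 1 / (od z.1 ^ 3 * (od z.1 + od z.2) ^ 2) +
      ∑' z : ℕ × ℕ, 1 / (od z.1 ^ 2 * od z.2 * (od z.1 + od z.2) ^ 2) +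
      ∑' z : ℕ × ℕ, 1 / (od z.1 ^ 2 * od z.2 ^ 2 * (od z.1 + od z.2)) := by
    have h3 := summable_od (s := 3) (by norm_num)
    have h32 : Summable fun z : ℕ × ℕ => 1 / od z.1 ^ 3 * (1 / od z.2 ^ 2) :=
      h3.mul_of_nonneg (summable_od le_rfl)
        (fun k => (one_div_pos.2 (pow_pos (od_pos k) 3)).le) (fun k => by positivity)
    rw [← hU.tsum_add hV, ← (hU.add hV).tsum_add summable_tornheim,
      h3.tsum_mul_tsum (summable_od le_rfl) h32]
    refine tsum_congr fun z => ?_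
    have h1 := od_pos z.1
    have h2 := od_pos z.2
    field_simp
    ring
  rw [tsum_od_two, tsum_tornheim] at hprod
  rw [tsum_tornheim, ← hswap] at hVT
  have : ∑' z : ℕ × ℕ, 1 / (od z.1 ^ 3 * (od z.1 + od z.2) ^ 2) =
      3 * ∑' k, 1 / od k ^ 5 - Real.pi ^ 2 / 4 * ∑' k, 1 / od k ^ 3 := by linarith
  rw [← this]
  exact hU.hasSum

lemma tsum_od_five : ((∑' k, 1 / od k ^ 5 : ℝ) : ℂ) = 31 / 32 * riemannZeta 5 := by
  have hz : riemannZeta 5 = ((∑' n : ℕ, 1 / (n : ℝ) ^ 5 : ℝ) : ℂ) := by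
    have := zeta_nat_eq_tsum_of_gt_one (k := 5) (by norm_num)
    push_cast at this ⊢
    exact this
  have hs : Summable fun n : ℕ => 1 / (n : ℝ) ^ 5 := Real.summable_one_div_nat_pow.2 (by norm_num)
  have he : (fun k : ℕ => 1 / ((2 * k : ℕ) : ℝ) ^ 5) = fun k : ℕ => 1 / 32 * (1 / (k : ℝ) ^ 5) := by
    ext k
    push_cast
    rw [mul_pow, one_div, one_div, one_div, mul_inv]
    norm_num
  have hsplit := tsum_even_add_odd (f := fun n : ℕ => 1 / (n : ℝ) ^ 5)
    (by rw [he]; exact hs.mul_left _) (by simpa only [od_eq] using summable_od (s := 5) (by norm_num))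
  rw [he, tsum_mul_left] at hsplit
  have h : ∑' k, 1 / od k ^ 5 = 31 / 32 * ∑' n : ℕ, 1 / (n : ℝ) ^ 5 := by
    simp only [od_eq]
    linarith
  rw [h, hz]
  push_cast
  rfl

/-! ### Laws of `|1 + x|` and of products of Cayley transforms. -/

/-- The fundamental theorem of calculus for a nonnegative derivative, with integrability as a
consequence, so that `f` may be singular at the endpoints. Integrals are taken in `ENNReal` so that
Tonelli's theorem needs only measurability. -/
lemma lintegral_Ioo_of_hasDerivAt {F f : ℝ → ℝ} {a b : ℝ} (hab : a ≤ b)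
    (hc : ContinuousOn F (Set.Icc a b)) (hd : ∀ x ∈ Set.Ioo a b, HasDerivAt F (f x) x)
    (h0 : ∀ x ∈ Set.Ioo a b, 0 ≤ f x) :
    ∫⁻ x in Set.Ioo a b, ENNReal.ofReal (f x) = ENNReal.ofReal (F b - F a) := by
  have hi : IntegrableOn f (Set.Ioc a b) :=
    intervalIntegral.integrableOn_deriv_of_nonneg hc hd h0
  have hi' : IntegrableOn f (Set.Ioo a b) := hi.mono_set Set.Ioo_subset_Ioc_self
  rw [← intervalIntegral.integral_eq_sub_of_hasDerivAt_of_le hab hc hd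
    ((intervalIntegrable_iff_integrableOn_Ioc_of_le hab).2 hi),
    intervalIntegral.integral_of_le hab, integral_Ioc_eq_integral_Ioo,
    ofReal_integral_eq_lintegral_ofReal hi'
      ((ae_restrict_iff' measurableSet_Ioo).2 (.of_forall h0))]

lemma norm_one_add_exp (θ : ℝ) : ‖1 + (Circle.exp θ : ℂ)‖ = 2 * |Real.cos (θ / 2)| := by
  have h : ‖1 + (Circle.exp θ : ℂ)‖ ^ 2 = (2 * |Real.cos (θ / 2)|) ^ 2 := by
    rw [← Complex.normSq_eq_norm_sq, Complex.normSq_apply, mul_pow, sq_abs, Real.cos_sq,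
      mul_div_cancel₀ _ two_ne_zero, Circle.coe_exp]
    simp only [Complex.add_re, Complex.one_re, Complex.exp_ofReal_mul_I_re, Complex.add_im,
      Complex.one_im, Complex.exp_ofReal_mul_I_im]
    linear_combination Real.sin_sq_add_cos_sq θ
  exact (pow_left_inj₀ (norm_nonneg _) (by positivity) two_ne_zero).1 h

lemma norm_one_sub_exp (θ : ℝ) : ‖1 - (Circle.exp θ : ℂ)‖ = 2 * |Real.sin (θ / 2)| := by
  have h : ‖1 - (Circle.exp θ : ℂ)‖ ^ 2 = (2 * |Real.sin (θ / 2)|) ^ 2 := by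
    rw [← Complex.normSq_eq_norm_sq, Complex.normSq_apply, mul_pow, sq_abs, Real.sin_sq, Real.cos_sq,
      mul_div_cancel₀ _ two_ne_zero, Circle.coe_exp]
    simp only [Complex.sub_re, Complex.one_re, Complex.exp_ofReal_mul_I_re, Complex.sub_im,
      Complex.one_im, Complex.exp_ofReal_mul_I_im]
    linear_combination Real.sin_sq_add_cos_sq θ
  exact (pow_left_inj₀ (norm_nonneg _) (by positivity) two_ne_zero).1 h

lemma lintegral_Icc_two_pi {g : ℝ → ENNReal} (hg : ∀ φ, g (2 * Real.pi - φ) = g φ) :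
    ∫⁻ θ in Set.Icc 0 (2 * Real.pi), g θ =
      ENNReal.ofReal 4 * ∫⁻ φ in Set.Ioo 0 (Real.pi / 2), g (2 * φ) := by
  have hpi := Real.pi_pos
  have h1 : (fun φ : ℝ => 2 * φ) '' Set.Ioo 0 (Real.pi / 2) = Set.Ioo 0 Real.pi := by
    rw [Set.image_mul_left_Ioo two_pos]; ring_nf
  have h2 : (fun φ : ℝ => 2 * Real.pi - 2 * φ) '' Set.Ioo 0 (Real.pi / 2) =
      Set.Ioo Real.pi (2 * Real.pi) := by
    have : (fun φ : ℝ => 2 * Real.pi - 2 * φ) =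
        (fun y => 2 * Real.pi - y) ∘ (fun φ : ℝ => 2 * φ) := rfl
    rw [this, Set.image_comp, h1, Set.image_const_sub_Ioo]
    ring_nf
  have e1 : ∫⁻ θ in Set.Ioo 0 Real.pi, g θ =
      ENNReal.ofReal 2 * ∫⁻ φ in Set.Ioo 0 (Real.pi / 2), g (2 * φ) := by
    rw [← h1, lintegral_image_eq_lintegral_abs_deriv_mul measurableSet_Ioo
      (f' := fun _ => 2) (fun x _ => by
        simpa using ((hasDerivAt_id x).const_mul (2 : ℝ)).hasDerivWithinAt)
      (fun x _ y _ h => by simpa using h), abs_two, lintegral_const_mul' _ _ ENNReal.ofReal_ne_top]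
  have e2 : ∫⁻ θ in Set.Ioo Real.pi (2 * Real.pi), g θ =
      ENNReal.ofReal 2 * ∫⁻ φ in Set.Ioo 0 (Real.pi / 2), g (2 * φ) := by
    rw [← h2, lintegral_image_eq_lintegral_abs_deriv_mul measurableSet_Ioo
      (f' := fun _ => -2) (fun x _ => by
        simpa using (((hasDerivAt_id x).const_mul (2 : ℝ)).const_sub (2 * Real.pi)).hasDerivWithinAt)
      (fun x _ y _ h => by simpa using h), abs_neg, abs_two,
      lintegral_const_mul' _ _ ENNReal.ofReal_ne_top]
    simp only [hg]
  have hu : Set.Ioo 0 (2 * Real.pi) = Set.Ioc 0 Real.pi ∪ Set.Ioo Real.pi (2 * Real.pi) :=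
    (Set.Ioc_union_Ioo_eq_Ioo hpi.le (by linarith)).symm
  rw [← setLIntegral_congr Ioo_ae_eq_Icc, hu, lintegral_union measurableSet_Ioo
    (Set.disjoint_left.2 fun x h1 h2 => not_lt.2 h1.2 h2.1), ← setLIntegral_congr Ioo_ae_eq_Ioc,
    e1, e2, ← add_mul, ← ENNReal.ofReal_add two_pos.le two_pos.le]
  norm_num

/-- The joint law of `|1 + x|` and `|1 - x|`. -/
lemma lintegral_norm_one_add_sub {f : ℝ → ℝ → ENNReal} (hf : Measurable (Function.uncurry f)) :
    ∫⁻ x : Circle, f ‖1 + (x : ℂ)‖ ‖1 - (x : ℂ)‖ ∂arc = ENNReal.ofReal (2 / Real.pi) *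
      ∫⁻ φ in Set.Ioo 0 (Real.pi / 2), f (2 * Real.cos φ) (2 * Real.sin φ) := by
  have hm : Measurable fun x : Circle => f ‖1 + (x : ℂ)‖ ‖1 - (x : ℂ)‖ :=
    hf.comp ((continuous_const.add continuous_circle_coe).norm.measurable.prodMk
      (continuous_const.sub continuous_circle_coe).norm.measurable)
  have hpi := Real.pi_pos
  rw [lintegral_arc hm]
  simp only [norm_one_add_exp, norm_one_sub_exp]
  rw [lintegral_Icc_two_pi (g := fun θ => f (2 * |Real.cos (θ / 2)|) (2 * |Real.sin (θ / 2)|)),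
    ← mul_assoc, ← ENNReal.ofReal_inv_of_pos (by positivity),
    ← ENNReal.ofReal_mul (by positivity)]
  · congr 1
    · congr 1
      field_simp
      norm_num
    · refine setLIntegral_congr_fun measurableSet_Ioo fun φ hφ => ?_
      rw [mul_div_cancel_left₀ _ two_ne_zero, abs_of_pos, abs_of_pos]
      · exact Real.sin_pos_of_pos_of_lt_pi hφ.1 (by linarith [hφ.2])
      · exact Real.cos_pos_of_mem_Ioo ⟨by linarith [hφ.1], hφ.2⟩
  · intro φ
    have : (2 * Real.pi - φ) / 2 = Real.pi - φ / 2 := by ring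
    simp only [this, Real.cos_pi_sub, Real.sin_pi_sub, abs_neg]

lemma arctan_image_Ioi : Real.arctan '' Set.Ioi 0 = Set.Ioo 0 (Real.pi / 2) := by
  ext φ
  constructor
  · rintro ⟨u, hu, rfl⟩
    exact ⟨Real.arctan_pos.2 hu, Real.arctan_lt_pi_div_two u⟩
  · rintro ⟨h1, h2⟩
    exact ⟨Real.tan φ, Real.tan_pos_of_pos_of_lt_pi_div_two h1 h2,
      Real.arctan_tan (by linarith [Real.pi_pos]) h2⟩

/-- The law of `|(1 - x) / (1 + x)|`. -/
lemma lintegral_norm_cayley {f : ℝ → ENNReal} (hf : Measurable f) :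
    ∫⁻ x : Circle, f ‖(1 - (x : ℂ)) / (1 + x)‖ ∂arc = ENNReal.ofReal (2 / Real.pi) *
      ∫⁻ u in Set.Ioi 0, ENNReal.ofReal (1 / (1 + u ^ 2)) * f u := by
  have h := lintegral_norm_one_add_sub (f := fun a b => f (b / a))
    (hf.comp (measurable_snd.div measurable_fst))
  simp only [norm_div]
  -- With `φ` uniform on `(0, π/2)` the ratio is `tan φ`; substitute `φ = arctan u`.
  rw [h, ← arctan_image_Ioi, lintegral_image_eq_lintegral_abs_deriv_mul measurableSet_Ioi
    (fun x _ => (Real.hasDerivAt_arctan x).hasDerivWithinAt) Real.arctan_injective.injOn]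
  congr 1
  refine setLIntegral_congr_fun measurableSet_Ioi fun u _ => ?_
  rw [mul_div_mul_left _ _ two_ne_zero, ← Real.tan_eq_sin_div_cos, Real.tan_arctan,
    abs_of_pos (by positivity)]

/-- The density of the product of two independent variables distributed like
`|(1 - x) / (1 + x)|`, up to a constant. -/
def prodDensity (t : ℝ) : ℝ := Real.log t / (t ^ 2 - 1)

/-- The multiplicative convolution of the density `1 / (1 + u²)` with itself, integrated by partial
fractions. At `t = 1` the formula for `prodDensity` degenerates to `0 / 0`. -/
lemma lintegral_Ioi_kernel {t : ℝ} (h0 : 0 < t) (h1 : t ≠ 1) :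
    ∫⁻ u in Set.Ioi (0 : ℝ), ENNReal.ofReal (u / ((1 + u ^ 2) * (u ^ 2 + t ^ 2))) =
      ENNReal.ofReal (prodDensity t) := by
  have ht : 1 - t ^ 2 ≠ 0 := by
    intro h
    apply h1
    nlinarith
  let F : ℝ → ℝ := fun u => 1 / (1 - t ^ 2) * (1 / 2 * (Real.log (u ^ 2 + t ^ 2) - Real.log (1 + u ^ 2)))
  have hd : ∀ u ∈ Set.Ici (0 : ℝ), HasDerivAt F (u / ((1 + u ^ 2) * (u ^ 2 + t ^ 2))) u := by
    intro u _
    have p1 : u ^ 2 + t ^ 2 ≠ 0 := by positivity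
    have p2 : 1 + u ^ 2 ≠ 0 := by positivity
    have d1 : HasDerivAt (fun u : ℝ => u ^ 2 + t ^ 2) (2 * u) u := by
      simpa using (hasDerivAt_pow 2 u).add_const (t ^ 2)
    have d2 : HasDerivAt (fun u : ℝ => 1 + u ^ 2) (2 * u) u := by
      simpa using (hasDerivAt_pow 2 u).const_add 1
    refine ((((d1.log p1).sub (d2.log p2)).const_mul (1 / 2)).const_mul (1 / (1 - t ^ 2))).congr_deriv ?_
    field_simp
    ring
  have hpos : ∀ u ∈ Set.Ioi (0 : ℝ), 0 ≤ u / ((1 + u ^ 2) * (u ^ 2 + t ^ 2)) := fun u hu => by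
    have : 0 < u := hu
    positivity
  have hlim : Filter.Tendsto F Filter.atTop (nhds 0) := by
    have h2 : Filter.Tendsto (fun u : ℝ => 1 + u ^ 2) Filter.atTop Filter.atTop :=
      Filter.tendsto_atTop_add_const_left _ _ (Filter.tendsto_pow_atTop two_ne_zero)
    have h3 : Filter.Tendsto (fun u : ℝ => 1 + (t ^ 2 - 1) * (1 + u ^ 2)⁻¹) Filter.atTop (nhds 1) := by
      simpa using ((h2.inv_tendsto_atTop.const_mul (t ^ 2 - 1)).const_add 1)
    have h4 := ((Real.continuousAt_log one_ne_zero).tendsto.comp h3).const_mul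
      (1 / (1 - t ^ 2) * (1 / 2))
    rw [Real.log_one, mul_zero] at h4
    refine h4.congr fun u => ?_
    have p1 : u ^ 2 + t ^ 2 ≠ 0 := by positivity
    have p2 : 1 + u ^ 2 ≠ 0 := by positivity
    simp only [F, Function.comp]
    rw [← Real.log_div p1 p2, mul_assoc]
    congr 3
    field_simp
    ring
  have hi := integrableOn_Ioi_deriv_of_nonneg' hd hpos hlim
  rw [← ofReal_integral_eq_lintegral_ofReal hi
    ((ae_restrict_iff' measurableSet_Ioi).2 (.of_forall hpos)),
    integral_Ioi_of_hasDerivAt_of_nonneg' hd hpos hlim]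
  congr 1
  simp only [F, prodDensity]
  have ht' : t ^ 2 - 1 ≠ 0 := fun h => ht (by linarith)
  rw [show 1 - t ^ 2 = -(t ^ 2 - 1) by ring]
  simp
  field_simp
  ring

/-- The law of the product of two independent variables distributed like `|(1 - x) / (1 + x)|`. -/
lemma lintegral_lintegral_norm_cayley {G : ℝ → ENNReal} (hG : Measurable G) :
    ∫⁻ x : Circle, ∫⁻ y : Circle, G (‖(1 - (x : ℂ)) / (1 + x)‖ * ‖(1 - (y : ℂ)) / (1 + y)‖) ∂arc ∂arc =
      ENNReal.ofReal (4 / Real.pi ^ 2) *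
        ∫⁻ t in Set.Ioi 0, ENNReal.ofReal (prodDensity t) * G t := by
  have hpi := Real.pi_pos
  have hm1 : Measurable fun u : ℝ => ∫⁻ v in Set.Ioi 0, ENNReal.ofReal (1 / (1 + v ^ 2)) * G (u * v) := by
    apply Measurable.lintegral_prod_right'
      (f := fun z : ℝ × ℝ => ENNReal.ofReal (1 / (1 + z.2 ^ 2)) * G (z.1 * z.2))
    fun_prop
  have h1 : ∀ x : Circle,
      ∫⁻ y : Circle, G (‖(1 - (x : ℂ)) / (1 + x)‖ * ‖(1 - (y : ℂ)) / (1 + y)‖) ∂arc =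
      ENNReal.ofReal (2 / Real.pi) * ∫⁻ v in Set.Ioi 0, ENNReal.ofReal (1 / (1 + v ^ 2)) *
        G (‖(1 - (x : ℂ)) / (1 + x)‖ * v) := fun x =>
    lintegral_norm_cayley (f := fun v => G (‖(1 - (x : ℂ)) / (1 + x)‖ * v))
      (hG.comp (measurable_const_mul _))
  simp only [h1]
  rw [lintegral_const_mul' _ _ ENNReal.ofReal_ne_top, lintegral_norm_cayley hm1, ← mul_assoc,
    ← ENNReal.ofReal_mul (by positivity)]
  have h2 : ∀ u ∈ Set.Ioi (0 : ℝ), ENNReal.ofReal (1 / (1 + u ^ 2)) *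
      ∫⁻ v in Set.Ioi 0, ENNReal.ofReal (1 / (1 + v ^ 2)) * G (u * v) =
      ∫⁻ t in Set.Ioi 0, ENNReal.ofReal (u / ((1 + u ^ 2) * (u ^ 2 + t ^ 2))) * G t := by
    intro u hu
    have hu : 0 < u := hu
    have him : (fun t : ℝ => u⁻¹ * t) '' Set.Ioi 0 = Set.Ioi 0 := by
      rw [Set.image_mul_left_Ioi (by positivity)]; simp
    rw [← lintegral_const_mul' _ _ ENNReal.ofReal_ne_top]
    conv_lhs => rw [← him]
    rw [lintegral_image_eq_lintegral_abs_deriv_mul measurableSet_Ioi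
      (f' := fun _ => u⁻¹) (fun x _ => by
        simpa using ((hasDerivAt_id x).const_mul (u⁻¹)).hasDerivWithinAt)
      (fun x _ y _ h => by simpa [hu.ne'] using h)]
    refine setLIntegral_congr_fun measurableSet_Ioi fun t ht => ?_
    rw [mul_inv_cancel_left₀ hu.ne', ← mul_assoc, ← mul_assoc, ← ENNReal.ofReal_mul (by positivity),
      ← ENNReal.ofReal_mul (by positivity), abs_of_pos (by positivity)]
    congr 2
    have : 0 < t := ht
    field_simp
  rw [setLIntegral_congr_fun measurableSet_Ioi h2, lintegral_lintegral_swap]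
  · congr 1
    · congr 1
      ring
    · have hne : ∀ᵐ t : ℝ ∂volume, t ≠ 1 := by simp [ae_iff]
      refine lintegral_congr_ae ?_
      filter_upwards [ae_restrict_mem measurableSet_Ioi, ae_restrict_of_ae hne] with t ht ht1
      rw [lintegral_mul_const, lintegral_Ioi_kernel ht ht1]
      fun_prop
  · apply Measurable.aemeasurable
    unfold Function.uncurry
    fun_prop

/-- The measure with density `prodDensity` is invariant under `t ↦ 1/t`, so the part over `t > 1`
folds back onto `(0, 1)`. -/
lemma lintegral_Ioi_prodDensity (H : ℝ → ENNReal) :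
    ∫⁻ t in Set.Ioi 0, ENNReal.ofReal (prodDensity t) * H t =
      (∫⁻ t in Set.Ioo 0 1, ENNReal.ofReal (prodDensity t) * H t) +
      ∫⁻ t in Set.Ioo 0 1, ENNReal.ofReal (prodDensity t) * H t⁻¹ := by
  have him : (fun t : ℝ => t⁻¹) '' Set.Ioo 0 1 = Set.Ioi 1 := by
    rw [Set.image_inv_eq_inv, Set.inv_Ioo_0_left one_pos, inv_one]
  have hu : Set.Ioi (0 : ℝ) = Set.Ioc 0 1 ∪ Set.Ioi 1 := (Set.Ioc_union_Ioi_eq_Ioi zero_le_one).symm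
  rw [hu, lintegral_union measurableSet_Ioi
    (Set.disjoint_left.2 fun x h1 h2 => not_lt.2 h1.2 h2), ← setLIntegral_congr Ioo_ae_eq_Ioc,
    ← him]
  congr 1
  rw [lintegral_image_eq_lintegral_abs_deriv_mul (s := Set.Ioo (0 : ℝ) 1) measurableSet_Ioo
    (f' := fun x => -(x ^ 2)⁻¹) (fun x hx => (hasDerivAt_inv (ne_of_gt hx.1)).hasDerivWithinAt)
    (inv_injective.injOn)]
  refine setLIntegral_congr_fun measurableSet_Ioo fun t ht => ?_
  have h0 : 0 < t := ht.1
  rw [← mul_assoc, ← ENNReal.ofReal_mul (abs_nonneg _)]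
  congr 2
  have h2 : 1 - t ^ 2 ≠ 0 := by nlinarith [ht.2]
  have h3 : t ^ 2 - 1 ≠ 0 := by nlinarith [ht.2]
  rw [abs_neg, abs_of_pos (by positivity), prodDensity, prodDensity, Real.log_inv]
  have h4 : t⁻¹ ^ 2 - 1 = (1 - t ^ 2) / t ^ 2 := by field_simp
  rw [h4]
  field_simp
  ring

/-! ### The mean of `log⁺ (t |1 + y| / |1 + x|)`. -/

/-- Layer cake: `log⁺ (t B / A)` is the integral of `ds / s` over `A / B < s < t`. Its mean is then
governed by the probabilities of `A < s B`. -/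
lemma ofReal_posLog_eq_lintegral {A B t : ℝ} (hA : 0 < A) (hB : 0 < B) (ht : 0 < t) :
    ENNReal.ofReal (Real.posLog (t * B / A)) =
      ∫⁻ s in Set.Ioo 0 t, ENNReal.ofReal (1 / s) * {s | A < s * B}.indicator 1 s := by
  have hset : {s : ℝ | A < s * B} = Set.Ioi (A / B) := by
    ext s
    simp [div_lt_iff₀ hB]
  have hms : MeasurableSet {s : ℝ | A < s * B} := hset ▸ measurableSet_Ioi
  have h1 : (fun s => ENNReal.ofReal (1 / s) * {s | A < s * B}.indicator 1 s) =
      {s | A < s * B}.indicator fun s => ENNReal.ofReal (1 / s) := by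
    ext s
    by_cases h : s ∈ {s | A < s * B} <;> simp [h]
  have hAB : 0 < A / B := div_pos hA hB
  rw [h1, lintegral_indicator hms, Measure.restrict_restrict hms, hset]
  have hset2 : Set.Ioi (A / B) ∩ Set.Ioo 0 t = Set.Ioo (A / B) t := by
    ext s
    simp only [Set.mem_inter_iff, Set.mem_Ioi, Set.mem_Ioo]
    exact ⟨fun h => ⟨h.1, h.2.2⟩, fun h => ⟨h.1, hAB.trans h.1, h.2⟩⟩
  rw [hset2]
  rcases le_total (A / B) t with h | h
  · rw [lintegral_Ioo_of_hasDerivAt (F := Real.log) h]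
    · congr 1
      rw [Real.posLog_eq_log, ← Real.log_div ht.ne' hAB.ne']
      · congr 1
        field_simp
      · rw [abs_of_pos (by positivity), le_div_iff₀ hA, one_mul]
        rwa [div_le_iff₀ hB] at h
    · exact Real.continuousOn_log.mono fun s hs => (hAB.trans_le hs.1).ne'
    · intro s hs
      simpa using Real.hasDerivAt_log (hAB.trans hs.1).ne'
    · intro s hs
      exact one_div_nonneg.2 (hAB.trans hs.1).le
  · rw [Set.Ioo_eq_empty (not_lt.2 h), Measure.restrict_empty, lintegral_zero_measure,
      ENNReal.ofReal_eq_zero, Real.posLog_eq_zero_iff _ |>.2]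
    rw [abs_of_pos (by positivity), div_le_one hA]
    rwa [le_div_iff₀ hB] at h

lemma volume_cos_lt {c : ℝ} (h0 : 0 < c) (h1 : c < 1) :
    volume.restrict (Set.Ioo 0 (Real.pi / 2)) {φ | Real.cos φ < c} =
      ENNReal.ofReal (Real.arcsin c) := by
  have hm : MeasurableSet {φ | Real.cos φ < c} :=
    measurableSet_lt Real.measurable_cos measurable_const
  have hset : {φ | Real.cos φ < c} ∩ Set.Ioo 0 (Real.pi / 2) =
      Set.Ioo (Real.arccos c) (Real.pi / 2) := by
    have hpi := Real.pi_pos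
    ext φ
    constructor
    · rintro ⟨h, h2, h3⟩
      refine ⟨?_, h3⟩
      by_contra hle
      have := Real.cos_le_cos_of_nonneg_of_le_pi h2.le (Real.arccos_le_pi c) (not_lt.1 hle)
      rw [Real.cos_arccos (by linarith) h1.le] at this
      exact absurd h (not_lt.2 this)
    · rintro ⟨h2, h3⟩
      have h4 := Real.arccos_nonneg c
      refine ⟨?_, by linarith, h3⟩
      have := Real.cos_lt_cos_of_nonneg_of_le_pi h4 (by linarith) h2
      rwa [Real.cos_arccos (by linarith) h1.le] at this
  rw [Measure.restrict_apply hm, hset, Real.volume_Ioo, Real.arcsin_eq_pi_div_two_sub_arccos]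

lemma ofReal_arcsin_mul {s c : ℝ} (hs0 : 0 < s) (hs1 : s < 1) (hc0 : 0 < c) (hc1 : c ≤ 1) :
    ENNReal.ofReal (Real.arcsin (s * c)) =
      ∫⁻ r in Set.Ioo 0 s, ENNReal.ofReal (c / √(1 - r ^ 2 * c ^ 2)) := by
  rw [lintegral_Ioo_of_hasDerivAt (F := fun r => Real.arcsin (r * c)) hs0.le]
  · simp
  · fun_prop
  · intro r hr
    have h1 : r * c < 1 := by nlinarith [hr.1, hr.2]
    have h2 : 0 < r * c := mul_pos hr.1 hc0
    have h := (Real.hasDerivAt_arcsin (x := r * c) (by linarith) h1.ne).comp r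
      ((hasDerivAt_id r).mul_const c)
    refine h.congr_deriv ?_
    rw [mul_pow]
    ring
  · intro r hr
    positivity

/-- Since `1 - r² cos² ψ = (1 - r²) + (r sin ψ)²`, the primitive is an inverse hyperbolic sine of a
multiple of `sin ψ`, up to constants; the value is `artanh r / r`. -/
lemma lintegral_cos_div_sqrt {r : ℝ} (hr0 : 0 < r) (hr1 : r < 1) :
    ∫⁻ ψ in Set.Ioo 0 (Real.pi / 2), ENNReal.ofReal
      (Real.cos ψ / √(1 - r ^ 2 * Real.cos ψ ^ 2)) = ∑' k, ENNReal.ofReal (r ^ (2 * k) / od k) := by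
  have hpi := Real.pi_pos
  have hpos : ∀ ψ : ℝ, 0 < 1 - r ^ 2 * Real.cos ψ ^ 2 := fun ψ => by
    have h1 := Real.cos_sq_le_one ψ
    nlinarith [sq_nonneg (Real.cos ψ)]
  have hpos2 : ∀ ψ ∈ Set.Icc 0 (Real.pi / 2), 0 < r * Real.sin ψ + √(1 - r ^ 2 * Real.cos ψ ^ 2) := by
    intro ψ hψ
    have h1 : 0 ≤ Real.sin ψ := Real.sin_nonneg_of_nonneg_of_le_pi hψ.1 (by linarith [hψ.2])
    have h2 := Real.sqrt_pos.2 (hpos ψ)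
    positivity
  rw [lintegral_Ioo_of_hasDerivAt
    (F := fun ψ => 1 / r * Real.log (r * Real.sin ψ + √(1 - r ^ 2 * Real.cos ψ ^ 2))) (by linarith)]
  · have hsum := (Real.hasSum_log_sub_log_of_abs_lt_one (x := r) (by rwa [abs_of_pos hr0])).mul_left
      (1 / (2 * r))
    rw [← ENNReal.ofReal_tsum_of_nonneg]
    · congr 1
      have e1 : (fun k : ℕ => 1 / (2 * r) * (2 * (1 / (2 * (k : ℝ) + 1)) * r ^ (2 * k + 1))) =
          fun k => r ^ (2 * k) / od k := by
        ext k
        have := od_pos k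
        rw [← od]
        field_simp
        ring
      rw [e1] at hsum
      rw [hsum.tsum_eq]
      simp only [Real.sin_pi_div_two, Real.cos_pi_div_two, Real.sin_zero, Real.cos_zero]
      have h3 : (1 : ℝ) - r ^ 2 * 1 ^ 2 = (1 + r) * (1 - r) := by ring
      rw [h3]
      simp only [mul_one, mul_zero, zero_add, ne_eq, OfNat.ofNat_ne_zero, not_false_eq_true,
        zero_pow, sub_zero, Real.sqrt_one]
      rw [Real.log_sqrt (mul_nonneg (by linarith) (by linarith)),
        Real.log_mul (by linarith) (by linarith), add_comm r 1]
      field_simp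
      ring
    · intro k
      have := od_pos k
      positivity
    · have e1 := hsum.summable
      convert! e1 using 2 with k
      have := od_pos k
      rw [← od]
      field_simp
      ring
  · refine ContinuousOn.mul continuousOn_const (ContinuousOn.log ?_ fun ψ hψ => (hpos2 ψ hψ).ne')
    fun_prop
  · intro ψ hψ
    have h1 := hpos ψ
    have h2 := hpos2 ψ (Set.Ioo_subset_Icc_self hψ)
    have h3 := Real.sqrt_pos.2 h1
    have d1 : HasDerivAt (fun ψ => 1 - r ^ 2 * Real.cos ψ ^ 2)
        (2 * r ^ 2 * Real.cos ψ * Real.sin ψ) ψ := by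
      refine ((((Real.hasDerivAt_cos ψ).pow 2).const_mul (r ^ 2)).const_sub 1).congr_deriv ?_
      ring
    have d2 := (((((Real.hasDerivAt_sin ψ).const_mul r).add (d1.sqrt h1.ne')).log h2.ne').const_mul
      (1 / r))
    refine d2.congr_deriv ?_
    simp only [Pi.add_apply]
    field_simp
    ring
  · intro ψ hψ
    have := Real.cos_pos_of_mem_Ioo ⟨by linarith [hψ.1], hψ.2⟩
    positivity

lemma lintegral_pow_Ioo {s : ℝ} (hs : 0 ≤ s) (n : ℕ) {c : ℝ} (hc : 0 ≤ c) :
    ∫⁻ r in Set.Ioo 0 s, ENNReal.ofReal (c * r ^ n) =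
      ENNReal.ofReal (c * (s ^ (n + 1) / (n + 1))) := by
  rw [lintegral_Ioo_of_hasDerivAt (F := fun r => c * (r ^ (n + 1) / (n + 1))) hs]
  · simp
  · fun_prop
  · intro r _
    refine (((hasDerivAt_pow (n + 1) r).div_const _).const_mul c).congr_deriv ?_
    push_cast
    have : (n : ℝ) + 1 ≠ 0 := by positivity
    field_simp
  · intro r hr
    have := hr.1
    positivity

/-- Write `arcsin (s cos ψ)` as an integral over `r < s`, exchange the integrals, and integrate the
series of `artanh r / r`. -/
lemma lintegral_arcsin_mul_cos {s : ℝ} (hs0 : 0 < s) (hs1 : s < 1) :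
    ∫⁻ ψ in Set.Ioo 0 (Real.pi / 2), ENNReal.ofReal (Real.arcsin (s * Real.cos ψ)) =
      ∑' k, ENNReal.ofReal (s ^ (2 * k + 1) / od k ^ 2) := by
  have h1 : ∀ ψ ∈ Set.Ioo 0 (Real.pi / 2), ENNReal.ofReal (Real.arcsin (s * Real.cos ψ)) =
      ∫⁻ r in Set.Ioo 0 s, ENNReal.ofReal (Real.cos ψ / √(1 - r ^ 2 * Real.cos ψ ^ 2)) :=
    fun ψ hψ => ofReal_arcsin_mul hs0 hs1
      (Real.cos_pos_of_mem_Ioo ⟨by linarith [hψ.1, Real.pi_pos], hψ.2⟩) (Real.cos_le_one ψ)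
  rw [setLIntegral_congr_fun measurableSet_Ioo h1, lintegral_lintegral_swap]
  · rw [setLIntegral_congr_fun measurableSet_Ioo
      fun r hr => lintegral_cos_div_sqrt hr.1 (hr.2.trans hs1), lintegral_tsum]
    · refine tsum_congr fun k => ?_
      have h2 := lintegral_pow_Ioo hs0.le (2 * k) (c := 1 / od k) (one_div_nonneg.2 (od_pos k).le)
      have e : (fun r : ℝ => ENNReal.ofReal (r ^ (2 * k) / od k)) =
          fun r => ENNReal.ofReal (1 / od k * r ^ (2 * k)) := by
        ext r; congr 1; ring
      rw [e, h2]
      congr 1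
      push_cast
      rw [← od]
      have := od_pos k
      field_simp
    · intro k
      fun_prop
  · apply Measurable.aemeasurable
    unfold Function.uncurry
    fun_prop

/-- The expectation of `log⁺ (t |1 + y| / |1 + x|)`. -/
def ratioLog (t : ℝ) : ENNReal :=
  ∫⁻ z : Circle × Circle, ENNReal.ofReal (Real.posLog (t * ‖1 + (z.2 : ℂ)‖ / ‖1 + (z.1 : ℂ)‖))
    ∂arc.prod arc

lemma measurable_norm_one_add : Measurable fun x : Circle => ‖1 + (x : ℂ)‖ :=
  (continuous_const.add continuous_circle_coe).norm.measurable

lemma lintegral_ratio_layer {s ψ : ℝ} (hs0 : 0 < s) (hs1 : s < 1)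
    (hψ : ψ ∈ Set.Ioo 0 (Real.pi / 2)) :
    ∫⁻ φ in Set.Ioo 0 (Real.pi / 2), ENNReal.ofReal (1 / s) *
      {s | 2 * Real.cos φ < s * (2 * Real.cos ψ)}.indicator 1 s =
      ENNReal.ofReal (1 / s) * ENNReal.ofReal (Real.arcsin (s * Real.cos ψ)) := by
  have hc := Real.cos_pos_of_mem_Ioo ⟨by linarith [hψ.1, Real.pi_pos], hψ.2⟩
  have hm : MeasurableSet {φ | Real.cos φ < s * Real.cos ψ} :=
    measurableSet_lt Real.measurable_cos measurable_const
  have h1 : ∀ φ, ({s | 2 * Real.cos φ < s * (2 * Real.cos ψ)}.indicator 1 s : ENNReal) =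
      {φ | Real.cos φ < s * Real.cos ψ}.indicator 1 φ := by
    intro φ
    have : 2 * Real.cos φ < s * (2 * Real.cos ψ) ↔ Real.cos φ < s * Real.cos ψ := by
      constructor <;> intro h <;> linarith
    simp only [Set.indicator_apply, Set.mem_ofPred_eq, this, Pi.one_apply]
  rw [lintegral_const_mul' _ _ ENNReal.ofReal_ne_top]
  simp only [h1]
  rw [lintegral_indicator_one hm, volume_cos_lt (mul_pos hs0 hc)]
  nlinarith [Real.cos_le_one ψ]

lemma ratioLog_eq_tsum {t : ℝ} (ht0 : 0 < t) (ht1 : t ≤ 1) :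
    ratioLog t = ENNReal.ofReal (4 / Real.pi ^ 2) *
      ∑' k, ENNReal.ofReal (t ^ (2 * k + 1) / od k ^ 3) := by
  have hpi := Real.pi_pos
  have hm0 : Measurable fun z : Circle × Circle =>
      ENNReal.ofReal (Real.posLog (t * ‖1 + (z.2 : ℂ)‖ / ‖1 + (z.1 : ℂ)‖)) :=
    (Real.continuous_posLog.measurable.comp
      (((measurable_norm_one_add.comp measurable_snd).const_mul t).div
        (measurable_norm_one_add.comp measurable_fst))).ennreal_ofReal
  have h1 : ∀ b : ℝ, ∫⁻ x : Circle, ENNReal.ofReal (Real.posLog (t * b / ‖1 + (x : ℂ)‖)) ∂arc =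
      ENNReal.ofReal (2 / Real.pi) * ∫⁻ φ in Set.Ioo 0 (Real.pi / 2),
        ENNReal.ofReal (Real.posLog (t * b / (2 * Real.cos φ))) := fun b =>
    lintegral_norm_one_add_sub (f := fun a _ => ENNReal.ofReal (Real.posLog (t * b / a)))
      (Real.continuous_posLog.measurable.comp
        (measurable_const.div measurable_fst)).ennreal_ofReal
  have h2 := lintegral_norm_one_add_sub (f := fun b _ => ∫⁻ φ in Set.Ioo 0 (Real.pi / 2),
        ENNReal.ofReal (Real.posLog (t * b / (2 * Real.cos φ)))) (by
    have : Measurable fun b : ℝ => ∫⁻ φ in Set.Ioo 0 (Real.pi / 2),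
        ENNReal.ofReal (Real.posLog (t * b / (2 * Real.cos φ))) := by
      apply Measurable.lintegral_prod_right'
        (f := fun z : ℝ × ℝ => ENNReal.ofReal (Real.posLog (t * z.1 / (2 * Real.cos z.2))))
      have := Real.continuous_posLog.measurable
      fun_prop
    exact this.comp measurable_fst)
  rw [ratioLog, lintegral_prod_symm' _ hm0]
  simp only [h1]
  rw [lintegral_const_mul' _ _ ENNReal.ofReal_ne_top, h2, ← mul_assoc,
    ← ENNReal.ofReal_mul (by positivity)]
  have hcos : ∀ ψ ∈ Set.Ioo 0 (Real.pi / 2), 0 < Real.cos ψ := fun ψ hψ =>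
    Real.cos_pos_of_mem_Ioo ⟨by linarith [hψ.1], hψ.2⟩
  -- Given `ψ`, the set of `φ` with `cos φ < s cos ψ` has length `arcsin (s cos ψ)`; `t ≤ 1` keeps
  -- `s cos ψ` below `1`.
  have h3 : ∀ ψ ∈ Set.Ioo 0 (Real.pi / 2), ∫⁻ φ in Set.Ioo 0 (Real.pi / 2),
      ENNReal.ofReal (Real.posLog (t * (2 * Real.cos ψ) / (2 * Real.cos φ))) =
      ∫⁻ s in Set.Ioo 0 t, ENNReal.ofReal (1 / s) *
        ENNReal.ofReal (Real.arcsin (s * Real.cos ψ)) := by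
    intro ψ hψ
    have h4 : ∀ φ ∈ Set.Ioo 0 (Real.pi / 2),
        ENNReal.ofReal (Real.posLog (t * (2 * Real.cos ψ) / (2 * Real.cos φ))) =
        ∫⁻ s in Set.Ioo 0 t, ENNReal.ofReal (1 / s) *
          {s | 2 * Real.cos φ < s * (2 * Real.cos ψ)}.indicator 1 s := fun φ hφ =>
      ofReal_posLog_eq_lintegral (mul_pos two_pos (hcos φ hφ)) (mul_pos two_pos (hcos ψ hψ)) ht0
    rw [setLIntegral_congr_fun measurableSet_Ioo h4, lintegral_lintegral_swap]
    · exact setLIntegral_congr_fun measurableSet_Ioo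
        fun s hs => lintegral_ratio_layer hs.1 (hs.2.trans_le ht1) hψ
    · apply Measurable.aemeasurable
      refine Measurable.mul (by fun_prop) ?_
      refine (measurable_one (β := ℝ × ℝ) (α := ENNReal)).indicator
        (s := {p : ℝ × ℝ | 2 * Real.cos p.1 < p.2 * (2 * Real.cos ψ)}) ?_
      exact measurableSet_lt (by fun_prop) (by fun_prop)
  rw [setLIntegral_congr_fun measurableSet_Ioo h3, lintegral_lintegral_swap]
  · congr 1
    · congr 1
      ring
    · have h5 : ∀ s ∈ Set.Ioo 0 t, ∫⁻ ψ in Set.Ioo 0 (Real.pi / 2), ENNReal.ofReal (1 / s) *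
          ENNReal.ofReal (Real.arcsin (s * Real.cos ψ)) =
          ∑' k, ENNReal.ofReal (1 / od k ^ 2 * s ^ (2 * k)) := by
        intro s hs
        have hs0 : 0 < s := hs.1
        rw [lintegral_const_mul' _ _ ENNReal.ofReal_ne_top,
          lintegral_arcsin_mul_cos hs0 (hs.2.trans_le ht1), ← ENNReal.tsum_mul_left]
        refine tsum_congr fun k => ?_
        have := od_pos k
        rw [← ENNReal.ofReal_mul (by positivity)]
        congr 1
        field_simp
        ring
      rw [setLIntegral_congr_fun measurableSet_Ioo h5, lintegral_tsum]
      · refine tsum_congr fun k => ?_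
        rw [lintegral_pow_Ioo ht0.le (2 * k) (by positivity)]
        congr 1
        push_cast
        rw [← od]
        have := od_pos k
        field_simp
      · intro k
        fun_prop
  · apply Measurable.aemeasurable
    unfold Function.uncurry
    fun_prop

lemma ratioLog_ne_top {t : ℝ} (ht0 : 0 < t) (ht1 : t ≤ 1) : ratioLog t ≠ ⊤ := by
  rw [ratioLog_eq_tsum ht0 ht1]
  refine ENNReal.mul_ne_top ENNReal.ofReal_ne_top ?_
  refine ne_top_of_le_ne_top (b := ∑' k, ENNReal.ofReal (1 / od k ^ 3)) ?_ ?_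
  · rw [← ENNReal.ofReal_tsum_of_nonneg
      (fun k => (one_div_pos.2 (pow_pos (od_pos k) 3)).le) (summable_od (by norm_num))]
    exact ENNReal.ofReal_ne_top
  · refine ENNReal.tsum_le_tsum fun k => ENNReal.ofReal_le_ofReal ?_
    have := od_pos k
    gcongr
    exact pow_le_one₀ ht0.le ht1

/-- Use `log⁺ v = log⁺ v⁻¹ + log v` with `v` the ratio at `t⁻¹`. Swapping `x` and `y` turns the
first term into the one at `t`, and in `log v` only `-log t` has nonzero mean. -/
lemma ratioLog_inv {t : ℝ} (ht0 : 0 < t) (ht1 : t ≤ 1) :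
    ratioLog t⁻¹ = ratioLog t + ENNReal.ofReal (-Real.log t) := by
  set g : Circle × Circle → ℝ :=
    fun z => Real.posLog (t * ‖1 + (z.2 : ℂ)‖ / ‖1 + (z.1 : ℂ)‖) with hg
  set h : Circle × Circle → ℝ :=
    fun z => Real.posLog (t⁻¹ * ‖1 + (z.2 : ℂ)‖ / ‖1 + (z.1 : ℂ)‖) with hh
  have hgm : Measurable g := Real.continuous_posLog.measurable.comp
      (((measurable_norm_one_add.comp measurable_snd).const_mul t).div
        (measurable_norm_one_add.comp measurable_fst))
  have hgi : Integrable g (arc.prod arc) := by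
    refine (lintegral_ofReal_ne_top_iff_integrable hgm.aestronglyMeasurable
      (.of_forall fun _ => Real.posLog_nonneg)).1 ?_
    exact ratioLog_ne_top ht0 ht1
  have hsw := Measure.measurePreserving_swap (μ := arc) (ν := arc)
  have hgi' : Integrable (fun z : Circle × Circle => g z.swap) (arc.prod arc) :=
    hsw.integrable_comp_of_integrable hgi
  have hgI : ∫ z, g z.swap ∂arc.prod arc = ∫ z, g z ∂arc.prod arc := integral_prod_swap g
  have hl1 : Integrable (fun z : Circle × Circle => Real.log ‖1 + (z.1 : ℂ)‖) (arc.prod arc) :=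
    integrable_log_norm_one_add.comp_fst arc
  have hl2 : Integrable (fun z : Circle × Circle => Real.log ‖1 + (z.2 : ℂ)‖) (arc.prod arc) :=
    integrable_log_norm_one_add.comp_snd arc
  have hI1 : ∫ z : Circle × Circle, Real.log ‖1 + (z.1 : ℂ)‖ ∂arc.prod arc = 0 := by
    rw [integral_fun_fst (fun x : Circle => Real.log ‖1 + (x : ℂ)‖), integral_log_norm_one_add, smul_zero]
  have hI2 : ∫ z : Circle × Circle, Real.log ‖1 + (z.2 : ℂ)‖ ∂arc.prod arc = 0 := by
    rw [integral_fun_snd (fun x : Circle => Real.log ‖1 + (x : ℂ)‖), integral_log_norm_one_add, smul_zero]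
  have hae : h =ᵐ[arc.prod arc] fun z => g z.swap + (Real.log ‖1 + (z.2 : ℂ)‖ -
      Real.log ‖1 + (z.1 : ℂ)‖) + -Real.log t := by
    filter_upwards [Measure.quasiMeasurePreserving_fst.ae ae_one_add_ne_zero,
      Measure.quasiMeasurePreserving_snd.ae ae_one_add_ne_zero] with z h1 h2
    have h1 := norm_ne_zero_iff.2 h1
    have h2 := norm_ne_zero_iff.2 h2
    have h3 := Real.posLog_sub_posLog_inv (x := t⁻¹ * ‖1 + (z.2 : ℂ)‖ / ‖1 + (z.1 : ℂ)‖)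
    rw [Real.log_div (by positivity) h1, Real.log_mul (by positivity) h2, Real.log_inv] at h3
    have h4 : (t⁻¹ * ‖1 + (z.2 : ℂ)‖ / ‖1 + (z.1 : ℂ)‖)⁻¹ =
        t * ‖1 + (z.1 : ℂ)‖ / ‖1 + (z.2 : ℂ)‖ := by field_simp
    rw [h4] at h3
    simp only [hh, hg, Prod.swap]
    linarith
  have hl : Integrable (fun z : Circle × Circle => Real.log ‖1 + (z.2 : ℂ)‖ -
      Real.log ‖1 + (z.1 : ℂ)‖) (arc.prod arc) := hl2.sub hl1
  have hi2 : Integrable (fun z : Circle × Circle => g z.swap + (Real.log ‖1 + (z.2 : ℂ)‖ -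
      Real.log ‖1 + (z.1 : ℂ)‖)) (arc.prod arc) := hgi'.add hl
  have hhi : Integrable h (arc.prod arc) := (hi2.add (integrable_const _)).congr hae.symm
  have hval : ∫ z, h z ∂arc.prod arc = ∫ z, g z ∂arc.prod arc + -Real.log t := by
    rw [integral_congr_ae hae, integral_add hi2 (integrable_const _), integral_add hgi' hl,
      integral_sub hl2 hl1, hI1, hI2, hgI]
    simp
  have e1 : ratioLog t⁻¹ = ENNReal.ofReal (∫ z, h z ∂arc.prod arc) :=
    (ofReal_integral_eq_lintegral_ofReal hhi (.of_forall fun _ => Real.posLog_nonneg)).symm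
  have e2 : ratioLog t = ENNReal.ofReal (∫ z, g z ∂arc.prod arc) :=
    (ofReal_integral_eq_lintegral_ofReal hgi (.of_forall fun _ => Real.posLog_nonneg)).symm
  rw [e1, e2, hval, ENNReal.ofReal_add (integral_nonneg fun _ => Real.posLog_nonneg)]
  linarith [Real.log_nonpos ht0.le ht1]

/-! ### Integration against `prodDensity`. -/

lemma continuous_pow_succ_mul_log (n : ℕ) : Continuous fun t : ℝ => t ^ (n + 1) * Real.log t := by
  have : (fun t : ℝ => t ^ (n + 1) * Real.log t) = fun t => t ^ n * (t * Real.log t) := by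
    ext t; ring
  rw [this]
  exact (continuous_pow n).mul Real.continuous_mul_log

lemma continuousOn_pow_succ_mul_log_sq (n : ℕ) :
    ContinuousOn (fun t : ℝ => t ^ (n + 1) * Real.log t ^ 2) (Set.Icc 0 1) := by
  -- For `t ≥ 0` one has `t log² t = 4 (√t log √t)²`, which reduces continuity at `0` to that of `t
  -- log t`.
  have hc : Continuous fun t : ℝ => 4 * t ^ n * (√t * Real.log √t) ^ 2 :=
    (continuous_const.mul (continuous_pow n)).mul
      ((Real.continuous_mul_log.comp Real.continuous_sqrt).pow 2)
  refine hc.continuousOn.congr fun t ht => ?_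
  simp only
  rw [Real.log_sqrt ht.1, mul_pow, Real.sq_sqrt ht.1]
  ring

lemma lintegral_pow_mul_neg_log (n : ℕ) :
    ∫⁻ t in Set.Ioo (0 : ℝ) 1, ENNReal.ofReal (t ^ n * -Real.log t) =
      ENNReal.ofReal (1 / ((n : ℝ) + 1) ^ 2) := by
  have hn : (n : ℝ) + 1 ≠ 0 := by positivity
  rw [lintegral_Ioo_of_hasDerivAt (F := fun t => t ^ (n + 1) / ((n : ℝ) + 1) ^ 2 -
    t ^ (n + 1) * Real.log t / ((n : ℝ) + 1)) zero_le_one]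
  · simp
  · exact (((continuous_pow _).div_const _).sub
      ((continuous_pow_succ_mul_log n).div_const _)).continuousOn
  · intro t ht
    have ht0 : t ≠ 0 := ht.1.ne'
    have d := hasDerivAt_pow (n + 1) t
    refine ((d.div_const (((n : ℝ) + 1) ^ 2)).sub
      ((d.mul (Real.hasDerivAt_log ht0)).div_const ((n : ℝ) + 1))).congr_deriv ?_
    push_cast
    field_simp
    ring
  · intro t ht
    have := Real.log_nonpos ht.1.le ht.2.le
    exact mul_nonneg (pow_nonneg ht.1.le n) (by linarith)

lemma lintegral_pow_mul_log_sq (n : ℕ) :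
    ∫⁻ t in Set.Ioo (0 : ℝ) 1, ENNReal.ofReal (t ^ n * Real.log t ^ 2) =
      ENNReal.ofReal (2 * (1 / ((n : ℝ) + 1) ^ 3)) := by
  have hn : (n : ℝ) + 1 ≠ 0 := by positivity
  rw [lintegral_Ioo_of_hasDerivAt (F := fun t => t ^ (n + 1) * Real.log t ^ 2 / ((n : ℝ) + 1) -
    2 * (t ^ (n + 1) * Real.log t) / ((n : ℝ) + 1) ^ 2 + 2 * t ^ (n + 1) / ((n : ℝ) + 1) ^ 3)
    zero_le_one]
  · simp [div_eq_mul_inv]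
  · exact ((((continuousOn_pow_succ_mul_log_sq n).div_const _).sub
      ((continuous_const.mul (continuous_pow_succ_mul_log n)).div_const _).continuousOn).add
        ((continuous_const.mul (continuous_pow _)).div_const _).continuousOn)
  · intro t ht
    have ht0 : t ≠ 0 := ht.1.ne'
    have d := hasDerivAt_pow (n + 1) t
    have dl := Real.hasDerivAt_log ht0
    refine ((((d.mul (dl.pow 2)).div_const ((n : ℝ) + 1)).sub
      (((d.mul dl).const_mul 2).div_const (((n : ℝ) + 1) ^ 2))).add
      ((d.const_mul 2).div_const (((n : ℝ) + 1) ^ 3))).congr_deriv ?_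
    push_cast
    simp only [Pi.pow_apply]
    field_simp
    ring
  · intro t ht
    exact mul_nonneg (pow_nonneg ht.1.le n) (sq_nonneg _)

/-- Expand `1 / (1 - t²)` as a geometric series; every term is nonnegative on `(0, 1)`. -/
lemma ofReal_prodDensity_mul {t c : ℝ} (ht : t ∈ Set.Ioo (0 : ℝ) 1) (hc : 0 ≤ c) :
    ENNReal.ofReal (prodDensity t) * ENNReal.ofReal c =
      ∑' j : ℕ, ENNReal.ofReal (c * (t ^ (2 * j) * -Real.log t)) := by
  have hl := Real.log_nonpos ht.1.le ht.2.le
  have h1 : t ^ 2 < 1 := by nlinarith [ht.1, ht.2]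
  have hs := ((hasSum_geometric_of_lt_one (sq_nonneg t) h1).mul_right (-Real.log t)).mul_left c
  have hn : ∀ j : ℕ, 0 ≤ c * ((t ^ 2) ^ j * -Real.log t) := fun j =>
    mul_nonneg hc (mul_nonneg (by positivity) (by linarith))
  have hpd : prodDensity t = (1 - t ^ 2)⁻¹ * -Real.log t := by
    have : 1 - t ^ 2 ≠ 0 := by linarith
    have h2 : t ^ 2 - 1 ≠ 0 := by linarith
    rw [prodDensity, show t ^ 2 - 1 = -(1 - t ^ 2) by ring, div_neg, div_eq_inv_mul]
    ring
  have hpd0 : 0 ≤ prodDensity t := by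
    rw [hpd]
    exact mul_nonneg (inv_nonneg.2 (by linarith)) (by linarith)
  simp only [pow_mul]
  rw [← ENNReal.ofReal_tsum_of_nonneg hn hs.summable, hs.tsum_eq, ← hpd,
    ← ENNReal.ofReal_mul hpd0, mul_comm]

lemma measurable_term (c : ℝ) (n : ℕ) :
    Measurable fun t : ℝ => ENNReal.ofReal (c * (t ^ n * -Real.log t)) := by
  have := Real.measurable_log
  fun_prop

lemma lintegral_prodDensity_mul_neg_log :
    ∫⁻ t in Set.Ioo 0 1, ENNReal.ofReal (prodDensity t) * ENNReal.ofReal (-Real.log t) =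
      ENNReal.ofReal (2 * ∑' k, 1 / od k ^ 3) := by
  have h1 : ∀ t ∈ Set.Ioo (0 : ℝ) 1, ENNReal.ofReal (prodDensity t) *
      ENNReal.ofReal (-Real.log t) = ∑' j : ℕ, ENNReal.ofReal (t ^ (2 * j) * Real.log t ^ 2) := by
    intro t ht
    rw [ofReal_prodDensity_mul ht (by linarith [Real.log_nonpos ht.1.le ht.2.le])]
    refine tsum_congr fun j => ?_
    congr 1
    ring
  rw [setLIntegral_congr_fun measurableSet_Ioo h1, lintegral_tsum (fun j => by
    have := Real.measurable_log
    fun_prop), ← tsum_mul_left, ENNReal.ofReal_tsum_of_nonneg]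
  · refine tsum_congr fun j => ?_
    rw [lintegral_pow_mul_log_sq, od]
    push_cast
    rfl
  · intro k
    have := od_pos k
    positivity
  · exact (summable_od (by norm_num)).mul_left 2

/-- The exponent `a - 1 + b`, with `a = 2k + 1` from `ratioLog` and `b = 2j + 1` from the geometric
series, integrates against `-log t` to `1 / (a + b)²`; this is the double sum of `hasSum_double`. -/
lemma lintegral_prodDensity_mul_ratioLog :
    ∫⁻ t in Set.Ioo 0 1, ENNReal.ofReal (prodDensity t) * ratioLog t =
      ENNReal.ofReal (4 / Real.pi ^ 2 *
        (3 * ∑' k, 1 / od k ^ 5 - Real.pi ^ 2 / 4 * ∑' k, 1 / od k ^ 3)) := by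
  have hpi := Real.pi_pos
  have h1 : ∀ t ∈ Set.Ioo (0 : ℝ) 1, ENNReal.ofReal (prodDensity t) * ratioLog t =
      ENNReal.ofReal (4 / Real.pi ^ 2) * ∑' k : ℕ, ∑' j : ℕ, ENNReal.ofReal
        (1 / od k ^ 3 * (t ^ (2 * k + 1 + 2 * j) * -Real.log t)) := by
    intro t ht
    have ht0 : 0 < t := ht.1
    rw [ratioLog_eq_tsum ht.1 ht.2.le, mul_left_comm, ← ENNReal.tsum_mul_left]
    congr 1
    refine tsum_congr fun k => ?_
    have := od_pos k
    rw [ofReal_prodDensity_mul ht (by positivity)]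
    refine tsum_congr fun j => ?_
    congr 1
    rw [pow_add t (2 * k + 1)]
    ring
  rw [setLIntegral_congr_fun measurableSet_Ioo h1, lintegral_const_mul' _ _ ENNReal.ofReal_ne_top,
    lintegral_tsum (fun k => (Measurable.tsum fun j => measurable_term _ _).aemeasurable)]
  have h2 : ∀ k : ℕ, ∫⁻ t in Set.Ioo (0 : ℝ) 1, ∑' j : ℕ, ENNReal.ofReal
        (1 / od k ^ 3 * (t ^ (2 * k + 1 + 2 * j) * -Real.log t)) =
      ∑' j : ℕ, ENNReal.ofReal (1 / (od k ^ 3 * (od k + od j) ^ 2)) := by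
    intro k
    have hk := od_pos k
    rw [lintegral_tsum (fun j => (measurable_term _ _).aemeasurable)]
    refine tsum_congr fun j => ?_
    have hk3 : 0 ≤ 1 / od k ^ 3 := by positivity
    simp only [ENNReal.ofReal_mul hk3]
    rw [lintegral_const_mul' _ _ ENNReal.ofReal_ne_top, lintegral_pow_mul_neg_log,
      ← ENNReal.ofReal_mul hk3, one_div_mul_one_div]
    congr 4
    push_cast [od]
    ring
  simp only [h2]
  rw [← ENNReal.tsum_prod (f := fun k j => ENNReal.ofReal (1 / (od k ^ 3 * (od k + od j) ^ 2))),
    ENNReal.ofReal_mul (by positivity), ← hasSum_double.tsum_eq,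
    ENNReal.ofReal_tsum_of_nonneg _ hasSum_double.summable]
  intro z
  have h1 := od_pos z.1
  have h2 := od_pos z.2
  positivity

lemma measurable_ratioLog : Measurable ratioLog := by
  refine Measurable.lintegral_prod_right' (f := fun q : ℝ × (Circle × Circle) => ENNReal.ofReal
    (Real.posLog (q.1 * ‖1 + (q.2.2 : ℂ)‖ / ‖1 + (q.2.1 : ℂ)‖))) ?_
  exact (Real.continuous_posLog.measurable.comp
      ((measurable_fst.mul (measurable_norm_one_add.comp (measurable_snd.comp measurable_snd))).div
        (measurable_norm_one_add.comp (measurable_fst.comp measurable_snd)))).ennreal_ofReal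

/-- The two halves of `(0, ∞)` contribute the double sum twice and `2 ∑ 1/a³` once; with the
constant `4/π²` in front of the double sum, the sums of cubes cancel. -/
lemma lintegral_ratioLog_cayley :
    ∫⁻ x : Circle, ∫⁻ y : Circle,
        ratioLog (‖(1 - (x : ℂ)) / (1 + x)‖ * ‖(1 - (y : ℂ)) / (1 + y)‖) ∂arc ∂arc =
      ENNReal.ofReal (96 / Real.pi ^ 4 * ∑' k, 1 / od k ^ 5) := by
  have hpi := Real.pi_pos
  have h1 : ∀ t ∈ Set.Ioo (0 : ℝ) 1, ENNReal.ofReal (prodDensity t) * ratioLog t⁻¹ =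
      ENNReal.ofReal (prodDensity t) * ratioLog t +
        ENNReal.ofReal (prodDensity t) * ENNReal.ofReal (-Real.log t) := fun t ht => by
    rw [ratioLog_inv ht.1 ht.2.le, mul_add]
  have hpm : Measurable prodDensity := by
    have := Real.measurable_log
    unfold prodDensity
    fun_prop
  have h3 : 0 ≤ ∑' k, 1 / od k ^ 3 := tsum_nonneg fun k => by
    have := od_pos k
    positivity
  have hU : 0 ≤ 3 * ∑' k, 1 / od k ^ 5 - Real.pi ^ 2 / 4 * ∑' k, 1 / od k ^ 3 :=
    hasSum_double.nonneg fun z => by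
      have h1 := od_pos z.1
      have h2 := od_pos z.2
      positivity
  have hU' : 0 ≤ 4 / Real.pi ^ 2 *
      (3 * ∑' k, 1 / od k ^ 5 - Real.pi ^ 2 / 4 * ∑' k, 1 / od k ^ 3) := by positivity
  rw [lintegral_lintegral_norm_cayley measurable_ratioLog, lintegral_Ioi_prodDensity,
    setLIntegral_congr_fun measurableSet_Ioo h1,
    lintegral_add_left (f := fun t => ENNReal.ofReal (prodDensity t) * ratioLog t)
      (hpm.ennreal_ofReal.mul measurable_ratioLog),
    lintegral_prodDensity_mul_neg_log, lintegral_prodDensity_mul_ratioLog,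
    ← ENNReal.ofReal_add hU' (by positivity), ← ENNReal.ofReal_add hU' (by positivity),
    ← ENNReal.ofReal_mul (by positivity)]
  congr 1
  field_simp
  ring

/-! ### Jensen's formula and the Mahler measure of `S 2`. -/

lemma lintegral_torus_succ {n : ℕ} {f : (Fin (n + 1) → Circle) → ENNReal} (hf : Measurable f) :
    ∫⁻ x, f x ∂torus (n + 1) = ∫⁻ a, ∫⁻ x, f (Fin.cons a x) ∂torus n ∂arc := by
  have h := measurePreserving_cons n
  exact (h.lintegral_comp hf).symm.trans (lintegral_prod_symm' _ (hf.comp h.measurable))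

lemma measurable_norm_cayley : Measurable fun x : Circle => ‖(1 - (x : ℂ)) / (1 + x)‖ :=
  ((continuous_const.sub continuous_circle_coe).measurable.div
    (continuous_const.add continuous_circle_coe).measurable).norm

/-- The value of `log⁺ |p (1 + y) / (1 + x)|` at the point `(x₁, x₂, x, y)`. -/
def posLogFun (w : Fin 4 → Circle) : ℝ :=
  Real.posLog (‖(1 - (w 0 : ℂ)) / (1 + w 0)‖ * ‖(1 - (w 1 : ℂ)) / (1 + w 1)‖ *
    ‖1 + (w 3 : ℂ)‖ / ‖1 + (w 2 : ℂ)‖)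

lemma measurable_posLogFun : Measurable posLogFun :=
  Real.continuous_posLog.measurable.comp
    ((((measurable_norm_cayley.comp (measurable_pi_apply 0)).mul
      (measurable_norm_cayley.comp (measurable_pi_apply 1))).mul
      (measurable_norm_one_add.comp (measurable_pi_apply 3))).div
      (measurable_norm_one_add.comp (measurable_pi_apply 2)))

lemma lintegral_posLogFun : ∫⁻ w, ENNReal.ofReal (posLogFun w) ∂torus 4 =
    ENNReal.ofReal (96 / Real.pi ^ 4 * ∑' k, 1 / od k ^ 5) := by
  have hm := measurable_posLogFun.ennreal_ofReal
  have hcons : ∀ (n : ℕ) (a : Circle), Measurable fun x : Fin n → Circle =>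
      (Fin.cons a x : Fin (n + 1) → Circle) := fun n a =>
    (measurePreserving_cons n).measurable.comp (measurable_id.prodMk measurable_const)
  rw [← lintegral_ratioLog_cayley, lintegral_torus_succ hm]
  refine lintegral_congr fun a => ?_
  have hm1 := hm.comp (hcons 3 a)
  refine (lintegral_torus_succ hm1).trans ?_
  refine lintegral_congr fun b => ?_
  have hm2 := hm1.comp (hcons 2 b)
  refine (lintegral_torus_succ hm2).trans ?_
  rw [ratioLog, lintegral_prod _ (by
    exact (Real.continuous_posLog.measurable.comp
      (((measurable_norm_one_add.comp measurable_snd).const_mul _).div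
        (measurable_norm_one_add.comp measurable_fst))).ennreal_ofReal.aemeasurable)]
  refine lintegral_congr fun c => ?_
  have hm3 := hm2.comp (hcons 1 c)
  refine (lintegral_torus_succ hm3).trans ?_
  refine lintegral_congr fun d => ?_
  have hconst : ∀ x : Fin 0 → Circle, ((fun w => ENNReal.ofReal (posLogFun w)) ∘
      (fun x => Fin.cons a x) ∘ (fun x => Fin.cons b x) ∘ fun x => Fin.cons c x)
        (Fin.cons d x) = ENNReal.ofReal
      (Real.posLog (‖(1 - (a : ℂ)) / (1 + a)‖ * ‖(1 - (b : ℂ)) / (1 + b)‖ *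
        ‖1 + (d : ℂ)‖ / ‖1 + (c : ℂ)‖)) := fun x => rfl
  refine (lintegral_congr hconst).trans ?_
  rw [lintegral_const, measure_univ, mul_one]

lemma integral_log_norm_mul_add {a : ℂ} (ha : a ≠ 0) (b : ℂ) :
    ∫ z : Circle, Real.log ‖a * z + b‖ ∂arc = Real.log ‖a‖ + Real.posLog (‖b‖ / ‖a‖) := by
  have h := integral_log_norm_polynomial (Polynomial.C a * Polynomial.X + Polynomial.C b)
  rw [Polynomial.logMahlerMeasure_C_mul_X_add_C ha] at h
  rw [norm_mul, norm_inv, inv_mul_eq_div] at h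
  rw [← h]
  simp

lemma mahlerMeasure_S_two : mahlerMeasure (S 2) = 96 / Real.pi ^ 4 * ∑' k, 1 / od k ^ 5 := by
  -- The rotation moves the variable added in front to the last place, that of `z`, so that Jensen's
  -- formula can be applied in `z` with the other four variables fixed.
  have hψ : MeasurePreserving (fun q : (Fin 4 → Circle) × Circle => fun i : Fin 5 =>
      (Fin.cons q.2 q.1 : Fin 5 → Circle) (finRotate 5 i)) ((torus 4).prod arc) (torus 5) :=
    (measurePreserving_comp_perm (finRotate 5)).comp (measurePreserving_cons 4)
  have hs : ∀ q : (Fin 4 → Circle) × Circle,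
      sFun (fun i : Fin 5 => (Fin.cons q.2 q.1 : Fin 5 → Circle) (finRotate 5 i)) =
      (1 + (q.1 2 : ℂ)) * q.2 + (1 - (q.1 0 : ℂ)) / (1 + q.1 0) *
        ((1 - (q.1 1 : ℂ)) / (1 + q.1 1)) * (1 + (q.1 3 : ℂ)) := fun q => rfl
  have hi : Integrable (fun q : (Fin 4 → Circle) × Circle => Real.log
      ‖(1 + (q.1 2 : ℂ)) * q.2 + (1 - (q.1 0 : ℂ)) / (1 + q.1 0) *
        ((1 - (q.1 1 : ℂ)) / (1 + q.1 1)) * (1 + (q.1 3 : ℂ))‖) ((torus 4).prod arc) := by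
    have := hψ.integrable_comp_of_integrable rep_S_two.integrable
    simpa only [Function.comp_def, hs] using this
  have h1 : mahlerMeasure (S 2) = ∫ q : (Fin 4 → Circle) × Circle, Real.log
      ‖(1 + (q.1 2 : ℂ)) * q.2 + (1 - (q.1 0 : ℂ)) / (1 + q.1 0) *
        ((1 - (q.1 1 : ℂ)) / (1 + q.1 1)) * (1 + (q.1 3 : ℂ))‖ ∂(torus 4).prod arc := by
    rw [rep_S_two.mahlerMeasure_eq]
    conv_lhs => rw [← hψ.map_eq]
    rw [integral_map hψ.measurable.aemeasurable
      (by rw [hψ.map_eq]; exact rep_S_two.integrable.aestronglyMeasurable)]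
    simp only [hs]
  have hae : (fun w : Fin 4 → Circle => ∫ z : Circle, Real.log
      ‖(1 + (w 2 : ℂ)) * z + (1 - (w 0 : ℂ)) / (1 + w 0) *
        ((1 - (w 1 : ℂ)) / (1 + w 1)) * (1 + (w 3 : ℂ))‖ ∂arc) =ᵐ[torus 4]
      fun w => Real.log ‖1 + (w 2 : ℂ)‖ + posLogFun w := by
    filter_upwards [ae_coord (n := 4) ae_one_add_ne_zero 2] with w hw
    rw [integral_log_norm_mul_add hw, norm_mul, norm_mul]
    rfl
  have hl := integrable_coord (n := 4) integrable_log_norm_one_add 2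
  -- Integrability of `log⁺` follows from that of `log |S 2|` by Fubini's theorem, through the
  -- almost everywhere identity `hae`.
  have hp : Integrable posLogFun (torus 4) := by
    refine ((hi.integral_prod_left.congr hae).sub hl).congr (.of_forall fun w => ?_)
    simp
  rw [h1, integral_prod _ hi, integral_congr_ae hae, integral_add hl hp,
    integral_coord (n := 4) integrable_log_norm_one_add 2, integral_log_norm_one_add, zero_add,
    integral_eq_lintegral_of_nonneg_ae (f := posLogFun) (.of_forall fun _ => Real.posLog_nonneg)
      measurable_posLogFun.aestronglyMeasurable, lintegral_posLogFun, ENNReal.toReal_ofReal]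
  have : 0 ≤ ∑' k, 1 / od k ^ 5 := tsum_nonneg fun k => by
    have := od_pos k
    positivity
  positivity

lemma mahlerMeasure_S_two_eq_zeta :
    (mahlerMeasure (S 2) : ℂ) = 93 / (Real.pi : ℂ) ^ 4 * riemannZeta 5 := by
  rw [mahlerMeasure_S_two]
  rw [Complex.ofReal_mul, tsum_od_five]
  push_cast
  ring

end MahlerInv

end

open MahlerInv in
theorem mainTheorem4 :
    ((HasMahlerMeasure P₁ ∧ (mahlerMeasure P₁ : ℂ) = 93 / (Real.pi : ℂ) ^ 4 * riemannZeta 5) ∧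
      (HasMahlerMeasure P₂ ∧ (mahlerMeasure P₂ : ℂ) = 93 / (Real.pi : ℂ) ^ 4 * riemannZeta 5) ∧
      (HasMahlerMeasure P₃ ∧ (mahlerMeasure P₃ : ℂ) = 93 / (Real.pi : ℂ) ^ 4 * riemannZeta 5)) ∧
    (∀ m : ℕ, 1 ≤ m →
      (HasMahlerMeasure (R m) ∧ HasMahlerMeasure (RTilde m) ∧
        mahlerMeasure (RTilde m) = mahlerMeasure (R m)) ∧
      (HasMahlerMeasure (S m) ∧ HasMahlerMeasure (STilde m) ∧
        mahlerMeasure (STilde m) = mahlerMeasure (S m)) ∧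
      (HasMahlerMeasure (T m) ∧ HasMahlerMeasure (TTilde m) ∧
        mahlerMeasure (TTilde m) = mahlerMeasure (T m))) := by
  refine ⟨⟨⟨hasMahlerMeasure _, ?_⟩, ⟨hasMahlerMeasure _, ?_⟩, ⟨hasMahlerMeasure _, ?_⟩⟩,
    fun m hm => ⟨⟨hasMahlerMeasure _, hasMahlerMeasure _, mahlerMeasure_RTilde hm⟩,
      ⟨hasMahlerMeasure _, hasMahlerMeasure _, mahlerMeasure_STilde hm⟩,
      ⟨hasMahlerMeasure _, hasMahlerMeasure _, mahlerMeasure_TTilde hm⟩⟩⟩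
  · rw [mahlerMeasure_P₁, mahlerMeasure_S_two_eq_zeta]
  · rw [mahlerMeasure_P₂, mahlerMeasure_S_two_eq_zeta]
  · rw [mahlerMeasure_P₃, mahlerMeasure_S_two_eq_zeta]
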